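/- Let $M^3$ be a smooth connected $3$-manifold with an almost contact metric structure $(\varphi,\xi,\eta,g)$, that is, a smooth $(1,1)$-tensor field $\varphi$, a smooth vector field $\xi$, a smooth $1$-form $\eta$ and a smooth Riemannian metric $g$ with $\varphi^2=-I+\eta\otimes\xi$, $\eta(\xi)=1$ and $g(\varphi X,\varphi Y)=g(X,Y)-\eta(X)\eta(Y)$. Assume that it is almost Kenmotsu: $d\eta=0$ and $d\Phi=2\eta\wedge\Phi$, where $\Phi(X,Y)=g(X,\varphi Y)$. Put $h=\frac12\mathcal L_\xi\varphi$ and $h'=h\circ\varphi$. Let $R_{XY}=[\nabla_X,\nabla_Y]-\nabla_{[X,Y]}$ be the curvature of the Levi-Civita connection $\nabla$ of $g$, and suppose that, for smooth functions $k,\mu:M\to\mathbb R$ and all vector fields $X,Y$, $$R_{XY}\xi=k\big(\eta(Y)X-\eta(X)Y\big)+\mu\big(\eta(Y)h'X-\eta(X)h'Y\big)$$ (an almost Kenmotsu generalized $(k,\mu)'$-space). Suppose that $dk\wedge\eta=0$ and that $k<-1$ everywhere on $M$. Then: (i) If $\mu=-2$ everywhere on $M$, then $k$ is constant. (ii) If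 $\mu\neq-2$ everywhere on $M$, then every point $p\in M$ has an open neighbourhood $U$ with smooth coordinates $x,y,z$ on $U$, $z<-1$, and a vector field $X$ on $U$, such that on $U$: $(\xi,X,\varphi X)$ is an orthonormal frame with $h'\xi=0$, $h'X=\lambda X$ and $h'\varphi X=-\lambda\varphi X$, where $\lambda=\sqrt{-1-k}$; $k=z$; $\mu$ is a smooth function of $z$ only; and $$X=\frac{\partial}{\partial x},\qquad \varphi X=\frac{\partial}{\partial y},\qquad \xi=a\frac{\partial}{\partial x}+b\frac{\partial}{\partial y}-2(z+1)(\mu+2)\frac{\partial}{\partial z},$$ where $a=x\big(1+\sqrt{-1-z}\big)+f(z)$ and $b=y\big(1-\sqrt{-1-z}\big)+r(z)$ for some smooth functions $f,r$ of $z$ on $U$. -/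

import Mathlib

open Bundle
open scoped Manifold ContDiff RealInnerProductSpace

noncomputable section

namespace AlmostKenmotsu

/-- The model space of a `3`-dimensional manifold. -/
abbrev E3 : Type := EuclideanSpace ℝ (Fin 3)

section VectorFields

variable {M : Type*} [TopologicalSpace M] [ChartedSpace E3 M] [IsManifold (𝓡 3) ∞ M]

/-- The vector field `X` is smooth at the point `p`. -/
def SmoothFieldAt (X : (p : M) → TangentSpace (𝓡 3) p) (p : M) : Prop :=
  ContMDiffAt (𝓡 3) ((𝓡 3).prod 𝓘(ℝ, E3)) ∞
    (fun q ↦ Bundle.TotalSpace.mk' E3 q (X q)) p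

/-- The Lie bracket `[X, Y]` of two vector fields. -/
abbrev bracket (X Y : (p : M) → TangentSpace (𝓡 3) p) : (p : M) → TangentSpace (𝓡 3) p :=
  VectorField.mlieBracket (𝓡 3) X Y

/-- The derivative `X(f)` of a function `f` along a vector field `X`. -/
def derivAlong (X : (p : M) → TangentSpace (𝓡 3) p) (f : M → ℝ) (p : M) : ℝ :=
  mvfderiv (𝓡 3) f p (X p)

/-- The exterior derivative of a `1`-form, evaluated on vector fields:
`dα(X, Y) = X(α(Y)) - Y(α(X)) - α([X, Y])`. -/
def extDerivOne (α : (p : M) → TangentSpace (𝓡 3) p → ℝ)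
    (X Y : (p : M) → TangentSpace (𝓡 3) p) (p : M) : ℝ :=
  derivAlong X (fun q ↦ α q (Y q)) p - derivAlong Y (fun q ↦ α q (X q)) p
    - α p (bracket X Y p)

/-- The exterior derivative of a `2`-form, evaluated on vector fields:
`dΦ(X, Y, Z)` is the cyclic sum of `X(Φ(Y, Z)) - Φ([X, Y], Z)`. -/
def extDerivTwo (Φ : (p : M) → TangentSpace (𝓡 3) p → TangentSpace (𝓡 3) p → ℝ)
    (X Y Z : (p : M) → TangentSpace (𝓡 3) p) (p : M) : ℝ :=
  derivAlong X (fun q ↦ Φ q (Y q) (Z q)) p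
    + derivAlong Y (fun q ↦ Φ q (Z q) (X q)) p
    + derivAlong Z (fun q ↦ Φ q (X q) (Y q)) p
    - Φ p (bracket X Y p) (Z p) - Φ p (bracket Y Z p) (X p) - Φ p (bracket Z X p) (Y p)

/-- The wedge product of two `1`-forms at a point, `(α ∧ β)(u, v) = α(u)β(v) - α(v)β(u)`. -/
def wedgeOneOne {V : Type*} (α β : V → ℝ) (u v : V) : ℝ :=
  α u * β v - α v * β u

/-- The wedge product of a `1`-form and a `2`-form at a point: `(α ∧ Φ)(u, v, w)` is the cyclic
sum of `α(u)Φ(v, w)`. -/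
def wedgeOneTwo {V : Type*} (α : V → ℝ) (Φ : V → V → ℝ) (u v w : V) : ℝ :=
  α u * Φ v w + α v * Φ w u + α w * Φ u v

/-- The curvature `R_{XY}Z = ∇_X ∇_Y Z - ∇_Y ∇_X Z - ∇_{[X, Y]} Z` of a connection. In Mathlib,
`∇_X Z` at `p` is written `nabla Z p (X p)`. -/
def curvature (nabla : CovariantDerivative (𝓡 3) E3 (fun p : M ↦ TangentSpace (𝓡 3) p))
    (X Y Z : (p : M) → TangentSpace (𝓡 3) p) (p : M) : TangentSpace (𝓡 3) p :=
  nabla (fun q ↦ nabla Z q (Y q)) p (X p) - nabla (fun q ↦ nabla Z q (X q)) p (Y p)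
    - nabla Z p (bracket X Y p)

/-- The coordinate vector field `∂/∂xᵢ` of a chart, i.e. the vector field which the differential
of the chart sends to the `i`-th standard basis vector. -/
def coordField (Ψ : OpenPartialHomeomorph M E3) (i : Fin 3) : (p : M) → TangentSpace (𝓡 3) p :=
  VectorField.mpullback (𝓡 3) 𝓘(ℝ, E3) Ψ (fun _ ↦ EuclideanSpace.single i (1 : ℝ))

end VectorFields

section Riemannian

variable (M : Type*) [TopologicalSpace M] [ChartedSpace E3 M] [IsManifold (𝓡 3) ∞ M]
  [RiemannianBundle (fun p : M ↦ TangentSpace (𝓡 3) p)]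

/-- An almost contact metric structure `(φ, ξ, η, g)` on a `3`-manifold. The Riemannian metric `g`
is the inner product `⟪u, v⟫` of the Riemannian structure of the tangent bundle. -/
structure AlmostContactMetric where
  phi : (p : M) → TangentSpace (𝓡 3) p →L[ℝ] TangentSpace (𝓡 3) p
  xi : (p : M) → TangentSpace (𝓡 3) p
  eta : (p : M) → TangentSpace (𝓡 3) p →L[ℝ] ℝ
  phi_smooth : ContMDiff (𝓡 3) ((𝓡 3).prod 𝓘(ℝ, E3 →L[ℝ] E3)) ∞
    (fun p ↦ Bundle.TotalSpace.mk' (E3 →L[ℝ] E3)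
      (E := fun p : M ↦ TangentSpace (𝓡 3) p →L[ℝ] TangentSpace (𝓡 3) p) p (phi p))
  xi_smooth : ContMDiff (𝓡 3) ((𝓡 3).prod 𝓘(ℝ, E3)) ∞
    (fun p ↦ Bundle.TotalSpace.mk' E3 p (xi p))
  eta_smooth : ContMDiff (𝓡 3) ((𝓡 3).prod 𝓘(ℝ, E3 →L[ℝ] ℝ)) ∞
    (fun p ↦ Bundle.TotalSpace.mk' (E3 →L[ℝ] ℝ)
      (E := fun p : M ↦ TangentSpace (𝓡 3) p →L[ℝ] ℝ) p (eta p))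
  phi_sq : ∀ (p : M) (v : TangentSpace (𝓡 3) p), phi p (phi p v) = -v + eta p v • xi p
  eta_xi : ∀ p : M, eta p (xi p) = 1
  compatible : ∀ (p : M) (u v : TangentSpace (𝓡 3) p),
    ⟪phi p u, phi p v⟫ = ⟪u, v⟫ - eta p u * eta p v

variable {M}

namespace AlmostContactMetric

variable (S : AlmostContactMetric M)

/-- The fundamental `2`-form `Φ(u, v) = g(u, φ v)`. -/
def fundForm (p : M) (u v : TangentSpace (𝓡 3) p) : ℝ := ⟪u, S.phi p v⟫

/-- Almost Kenmotsu structures: `dη = 0` and `dΦ = 2 η ∧ Φ`. -/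
structure IsAlmostKenmotsu : Prop where
  eta_closed : ∀ (X Y : (p : M) → TangentSpace (𝓡 3) p) (p : M),
    SmoothFieldAt X p → SmoothFieldAt Y p →
      extDerivOne (fun q v ↦ S.eta q v) X Y p = 0
  d_fundForm : ∀ (X Y Z : (p : M) → TangentSpace (𝓡 3) p) (p : M),
    SmoothFieldAt X p → SmoothFieldAt Y p → SmoothFieldAt Z p →
      extDerivTwo S.fundForm X Y Z p
        = 2 * wedgeOneTwo (S.eta p) (S.fundForm p) (X p) (Y p) (Z p)

/-- The vector field `φ X`. -/
def phiField (X : (p : M) → TangentSpace (𝓡 3) p) : (p : M) → TangentSpace (𝓡 3) p :=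
  fun p ↦ S.phi p (X p)

/-- The tensor field `h = (1/2) 𝓛_ξ φ`, acting on vector fields:
`h X = (1/2) ([ξ, φ X] - φ [ξ, X])`. -/
def h (X : (p : M) → TangentSpace (𝓡 3) p) : (p : M) → TangentSpace (𝓡 3) p :=
  fun p ↦ (1 / 2 : ℝ) • (bracket S.xi (S.phiField X) p - S.phi p (bracket S.xi X p))

/-- The tensor field `h' = h ∘ φ`, acting on vector fields. -/
def h' (X : (p : M) → TangentSpace (𝓡 3) p) : (p : M) → TangentSpace (𝓡 3) p :=
  S.h (S.phiField X)

/-- The generalized `(k, μ)'`-nullity condition with respect to the connection `nabla`: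
`R_{XY} ξ = k (η(Y) X - η(X) Y) + μ (η(Y) h' X - η(X) h' Y)` for all vector fields `X`, `Y`. -/
def KMuPrimeNullity (nabla : CovariantDerivative (𝓡 3) E3 (fun p : M ↦ TangentSpace (𝓡 3) p))
    (k μ : M → ℝ) : Prop :=
  ∀ (X Y : (p : M) → TangentSpace (𝓡 3) p) (p : M),
    SmoothFieldAt X p → SmoothFieldAt Y p →
      curvature nabla X Y S.xi p
        = k p • (S.eta p (Y p) • X p - S.eta p (X p) • Y p)
          + μ p • (S.eta p (Y p) • S.h' X p - S.eta p (X p) • S.h' Y p)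

end AlmostContactMetric

/-- A smooth Riemannian metric is in particular of class `C¹`. -/
instance instRiemannianOne
    [IsContMDiffRiemannianBundle (𝓡 3) ∞ E3 (fun p : M ↦ TangentSpace (𝓡 3) p)] :
    IsContMDiffRiemannianBundle (𝓡 3) 1 E3 (fun p : M ↦ TangentSpace (𝓡 3) p) :=
  IsContMDiffRiemannianBundle.of_le (n := ∞) (by norm_cast)

/-- `nabla` is the Levi-Civita connection: it is compatible with the metric and torsion-free. -/
structure IsLeviCivita
    [IsContMDiffRiemannianBundle (𝓡 3) ∞ E3 (fun p : M ↦ TangentSpace (𝓡 3) p)]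
    (nabla : CovariantDerivative (𝓡 3) E3 (fun p : M ↦ TangentSpace (𝓡 3) p)) : Prop where
  metric : nabla.IsMetricCompatible
  torsion_free : nabla.torsion = 0

end Riemannian

end AlmostKenmotsu

end

/-! Everything is read off from the operator A = ∇ξ. Closedness of η makes A symmetric and gives Aξ
= 0; the equation dΦ = 2η∧Φ gives tr A = 2. On ker η these facts yield h' = A - 1 (`h'_eq`).

The nullity condition on pairs (e, ξ) is a Riccati equation for A along ξ. Adding its diagonal
components for e and φe cancels the derivative and the μ term and leaves (A - 1)² = -1 - k on ker η
(`sq_add_sq`). As k < -1, A has the distinct eigenvalues 1 ± λ on ker η, λ = √(-1 - k), and a smooth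
unit eigenfield X exists locally. In the frame (ξ, X, φX) the diagonal part of the Riccati equation
becomes ξ(λ) = -λ(μ + 2), that is ξ(k) = -2(k + 1)(μ + 2), and the off-diagonal part becomes ∇_ξ X =
0. Since dk = ξ(k)η, this proves (i).

For (ii), λ is constant along ker η, so R(X, φX)ξ = 0 forces ∇_v X = -(1 + λ)g(X, v)ξ and ∇_v φX =
-(1 - λ)g(φX, v)ξ (`nabla_eq`, `nabla_phi_eq`). An integrating factor then gives functions with dx =
X♭ + x(1 + λ)η and dy = (φX)♭ + y(1 - λ)η (`exists_coordinate`). As μ ≠ -2, dk is a nonvanishing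
multiple of η, so (x, y, k) is a chart, and the values of dx, dy, dk on the frame are the
coefficients sought. Closedness of η finally shows that μ depends on k alone. -/

noncomputable section

open scoped Topology
open Filter

namespace AlmostKenmotsu

/-! ### Pointwise algebra of almost contact metric structures. -/

section

namespace AlmostContactMetric

section Algebra

variable {M : Type*} [TopologicalSpace M] [ChartedSpace E3 M] [IsManifold (𝓡 3) ∞ M]
  [RiemannianBundle (fun p : M ↦ TangentSpace (𝓡 3) p)] (S : AlmostContactMetric M)

/-- Since φ²ξ = 0, evaluating φ³ξ by `phi_sq` gives φξ = tξ with t = η(φξ). Applying φ once more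
gives tφξ = 0, and either factor vanishing yields φξ = 0. -/
theorem phi_xi (p : M) : S.phi p (S.xi p) = 0 := by
  have h1 : S.phi p (S.phi p (S.xi p)) = 0 := by simp [S.phi_sq, S.eta_xi]
  have h2 := S.phi_sq p (S.phi p (S.xi p))
  rw [h1, map_zero] at h2
  have h3 : S.phi p (S.xi p) = S.eta p (S.phi p (S.xi p)) • S.xi p :=
    (neg_add_eq_zero.1 h2.symm)
  have h4 := congrArg (S.phi p) h3
  rw [h1, map_smul] at h4
  rcases smul_eq_zero.1 h4.symm with h | h
  · rw [h3, h, zero_smul]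
  · exact h

theorem eta_eq_inner (p : M) (v : TangentSpace (𝓡 3) p) : S.eta p v = ⟪S.xi p, v⟫ := by
  have := S.compatible p (S.xi p) v
  rw [phi_xi, inner_zero_left, eta_xi] at this
  linarith

theorem inner_xi_xi (p : M) : ⟪S.xi p, S.xi p⟫ = 1 := by
  rw [← eta_eq_inner, eta_xi]

theorem eta_phi (p : M) (v : TangentSpace (𝓡 3) p) : S.eta p (S.phi p v) = 0 := by
  have := S.compatible p (S.xi p) (S.phi p v)
  rw [phi_xi, inner_zero_left, eta_xi, ← eta_eq_inner] at this
  have h1 := S.phi_sq p (S.phi p v)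
  rw [S.phi_sq p v, map_add, map_smul, phi_xi, map_neg, smul_zero, add_zero] at h1
  have h2 : S.eta p (S.phi p v) • S.xi p = 0 := by
    simpa using h1
  have h3 := congrArg (S.eta p) h2
  simpa [eta_xi] using h3

theorem phi_phi {p : M} {v : TangentSpace (𝓡 3) p} (hv : S.eta p v = 0) :
    S.phi p (S.phi p v) = -v := by
  rw [phi_sq, hv, zero_smul, add_zero]

theorem inner_phi (p : M) (u v : TangentSpace (𝓡 3) p) : ⟪S.phi p u, v⟫ = -⟪u, S.phi p v⟫ := by
  have h := S.compatible p u (S.phi p v)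
  rw [phi_sq, inner_add_right, inner_neg_right, inner_smul_right, eta_phi, real_inner_comm (S.xi p),
    ← eta_eq_inner, eta_phi] at h
  linarith

theorem inner_phi_self (p : M) (u : TangentSpace (𝓡 3) p) : ⟪u, S.phi p u⟫ = 0 := by
  have h := S.inner_phi p u u
  rw [real_inner_comm] at h
  linarith

theorem inner_phi_phi {p : M} {v : TangentSpace (𝓡 3) p} (hv : S.eta p v = 0) :
    ⟪S.phi p v, S.phi p v⟫ = ⟪v, v⟫ := by
  rw [compatible, hv]; ring

theorem orthonormal_frame {p : M} {u : TangentSpace (𝓡 3) p} (hu : ⟪u, u⟫ = 1)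
    (h0 : S.eta p u = 0) : Orthonormal ℝ ![S.xi p, u, S.phi p u] := by
  have h1 := S.inner_xi_xi p
  have h2 : ⟪S.xi p, u⟫ = 0 := by rw [← eta_eq_inner, h0]
  have h3 : ⟪S.xi p, S.phi p u⟫ = 0 := by rw [← eta_eq_inner, eta_phi]
  have h4 := S.inner_phi_self p u
  have h5 := S.inner_phi_phi h0
  rw [hu] at h5
  have h2' : ⟪u, S.xi p⟫ = 0 := by rw [real_inner_comm, h2]
  have h3' : ⟪S.phi p u, S.xi p⟫ = 0 := by rw [real_inner_comm, h3]
  have h4' : ⟪S.phi p u, u⟫ = 0 := by rw [real_inner_comm, h4]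
  rw [real_inner_self_eq_norm_sq, pow_eq_one_iff_of_nonneg (norm_nonneg _) two_ne_zero] at h1 h5 hu
  rw [orthonormal_iff_ite]
  intro i j
  fin_cases i <;> fin_cases j <;> simp [h1, h2, h3, h4, h5, hu, h2', h3', h4']

theorem frame_decomp {p : M} {u : TangentSpace (𝓡 3) p} (hu : ⟪u, u⟫ = 1)
    (h0 : S.eta p u = 0) (v : TangentSpace (𝓡 3) p) :
    v = S.eta p v • S.xi p + ⟪u, v⟫ • u + ⟪S.phi p u, v⟫ • S.phi p u := by
  have ho := S.orthonormal_frame hu h0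
  have hcard : Fintype.card (Fin 3) = Module.finrank ℝ (TangentSpace (𝓡 3) p) := by
    change _ = Module.finrank ℝ E3
    simp
  have : FiniteDimensional ℝ (TangentSpace (𝓡 3) p) :=
    inferInstanceAs (FiniteDimensional ℝ E3)
  let b := OrthonormalBasis.mk ho (by
    rw [← coe_basisOfOrthonormalOfCardEqFinrank ho hcard]
    exact (Module.Basis.span_eq _).ge)
  have h := b.sum_repr' v
  rw [Fin.sum_univ_three] at h
  simp only [b, OrthonormalBasis.coe_mk] at h
  rw [eta_eq_inner]
  exact h.symm

theorem h'_xi : S.h' S.xi = 0 := by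
  have : S.phiField S.xi = 0 := funext fun q ↦ S.phi_xi q
  have h2 : S.phiField (0 : (p : M) → TangentSpace (𝓡 3) p) = 0 := funext fun q ↦ map_zero _
  funext p
  simp only [h', h, this, h2, bracket, VectorField.mlieBracket_zero_right]
  simp

end Algebra

end AlmostContactMetric

end

/-! ### Smooth fields, derivatives and the Levi-Civita connection. -/

section

section Calculus

variable {M : Type*} [TopologicalSpace M] [ChartedSpace E3 M] [IsManifold (𝓡 3) ∞ M]
  {X Y : (p : M) → TangentSpace (𝓡 3) p} {p : M} {f : M → ℝ}

theorem SmoothFieldAt.mdifferentiableAt (hX : SmoothFieldAt X p) :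
    MDifferentiableAt (𝓡 3) ((𝓡 3).prod 𝓘(ℝ, E3))
      (fun q ↦ Bundle.TotalSpace.mk' E3 q (X q)) p :=
  ContMDiffAt.mdifferentiableAt hX (by simp)

theorem SmoothFieldAt.congr (hX : SmoothFieldAt X p) (h : ∀ᶠ q in 𝓝 p, Y q = X q) :
    SmoothFieldAt Y p := by
  refine ContMDiffAt.congr_of_eventuallyEq hX ?_
  filter_upwards [h] with q hq
  rw [hq]

theorem SmoothFieldAt.add (hX : SmoothFieldAt X p) (hY : SmoothFieldAt Y p) :
    SmoothFieldAt (X + Y) p :=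
  ContMDiffAt.add_section hX hY

theorem SmoothFieldAt.neg (hX : SmoothFieldAt X p) : SmoothFieldAt (-X) p :=
  ContMDiffAt.neg_section hX

theorem SmoothFieldAt.sub (hX : SmoothFieldAt X p) (hY : SmoothFieldAt Y p) :
    SmoothFieldAt (X - Y) p :=
  ContMDiffAt.sub_section hX hY

theorem SmoothFieldAt.smul (hf : ContMDiffAt (𝓡 3) 𝓘(ℝ, ℝ) ∞ f p) (hX : SmoothFieldAt X p) :
    SmoothFieldAt (f • X) p :=
  ContMDiffAt.smul_section hf hX

theorem SmoothFieldAt.const_smul (c : ℝ) (hX : SmoothFieldAt X p) : SmoothFieldAt (c • X) p :=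
  ContMDiffAt.const_smul_section hX

theorem SmoothFieldAt.bracket (hX : SmoothFieldAt X p) (hY : SmoothFieldAt Y p) :
    SmoothFieldAt (bracket X Y) p := by
  have : IsManifold (𝓡 3) ((∞ : WithTop ℕ∞) + 1) M := by
    simpa using (inferInstance : IsManifold (𝓡 3) ∞ M)
  have : IsManifold (𝓡 3) (minSmoothness ℝ 2) M := by
    rw [minSmoothness_of_isRCLikeNormedField]
    infer_instance
  exact ContMDiffAt.mlieBracket_vectorField (m := ⊤) (n := ⊤) hX hY (by simp)

theorem exists_smoothFieldAt (v : TangentSpace (𝓡 3) p) :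
    ∃ X : (q : M) → TangentSpace (𝓡 3) q, SmoothFieldAt X p ∧ X p = v :=
  ⟨FiberBundle.extend E3 v, FiberBundle.contMDiffAt_extend (𝓡 3) E3 v, FiberBundle.extend_apply_self E3 v⟩

theorem exists_smoothFieldAt_nhds (v : TangentSpace (𝓡 3) p) :
    ∃ X : (q : M) → TangentSpace (𝓡 3) q, (∀ᶠ q in 𝓝 p, SmoothFieldAt X q) ∧ X p = v := by
  obtain ⟨s, hs, h⟩ := FiberBundle.exists_contMDiffOn_extend (k := ∞) (𝓡 3) E3 v
  refine ⟨FiberBundle.extend E3 v, ?_, FiberBundle.extend_apply_self E3 v⟩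
  filter_upwards [eventually_mem_nhds_iff.2 hs] with q hq
  exact h.contMDiffAt hq

omit [IsManifold (𝓡 3) ∞ M] in
theorem mvfderiv_congr {g : M → ℝ} (h : ∀ᶠ q in 𝓝 p, f q = g q) :
    mvfderiv (𝓡 3) f p = mvfderiv (𝓡 3) g p := by
  have h' : f =ᶠ[𝓝 p] g := h
  ext v
  simp only [mvfderiv, ContinuousLinearMap.comp_apply]
  rw [h'.mfderiv_eq]
  rfl

omit [IsManifold (𝓡 3) ∞ M] in
theorem mvfderiv_eq_zero_of_eventually_const {c : ℝ} (h : ∀ᶠ q in 𝓝 p, f q = c) :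
    mvfderiv (𝓡 3) f p = 0 := by
  rw [mvfderiv_congr h, mvfderiv_const]

end Calculus

section Connection

variable {M : Type*} [TopologicalSpace M] [ChartedSpace E3 M] [IsManifold (𝓡 3) ∞ M]
  {X Y : (p : M) → TangentSpace (𝓡 3) p} {p : M} {f : M → ℝ}
  (nabla : CovariantDerivative (𝓡 3) E3 (fun p : M ↦ TangentSpace (𝓡 3) p))

theorem nabla_congr (hX : SmoothFieldAt X p) (h : ∀ᶠ q in 𝓝 p, Y q = X q) :
    nabla Y p = nabla X p :=
  nabla.isCovariantDerivativeOn.congr_of_eventuallyEq (hX.congr h).mdifferentiableAt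
    hX.mdifferentiableAt univ_mem h

theorem nabla_smul (hf : ContMDiffAt (𝓡 3) 𝓘(ℝ, ℝ) ∞ f p) (hX : SmoothFieldAt X p)
    (v : TangentSpace (𝓡 3) p) :
    nabla (f • X) p v = f p • nabla X p v + mvfderiv (𝓡 3) f p v • X p := by
  rw [nabla.isCovariantDerivativeOn.leibniz hX.mdifferentiableAt
    (hf.mdifferentiableAt (by simp))]
  simp

theorem nabla_neg (hX : SmoothFieldAt X p) : nabla (-X) p = -nabla X p := by
  have := nabla.isCovariantDerivativeOn.smul_const (-1 : ℝ) hX.mdifferentiableAt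
  simpa using this

theorem nabla_zero : nabla 0 p = 0 :=
  nabla.isCovariantDerivativeOn.zero

variable [RiemannianBundle (fun p : M ↦ TangentSpace (𝓡 3) p)]
  [IsContMDiffRiemannianBundle (𝓡 3) ∞ E3 (fun p : M ↦ TangentSpace (𝓡 3) p)]

theorem SmoothFieldAt.inner (hX : SmoothFieldAt X p) (hY : SmoothFieldAt Y p) :
    ContMDiffAt (𝓡 3) 𝓘(ℝ, ℝ) ∞ (fun q ↦ ⟪X q, Y q⟫) p :=
  ContMDiffAt.inner_bundle hX hY

variable {nabla}

theorem IsLeviCivita.mvfderiv_inner (hn : IsLeviCivita nabla) (hX : SmoothFieldAt X p)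
    (hY : SmoothFieldAt Y p) (v : TangentSpace (𝓡 3) p) :
    mvfderiv (𝓡 3) (fun q ↦ ⟪X q, Y q⟫) p v = ⟪nabla X p v, Y p⟫ + ⟪X p, nabla Y p v⟫ := by
  obtain ⟨V, -, rfl⟩ := exists_smoothFieldAt v
  exact hn.metric.mvfderiv_inner_eq V hX.mdifferentiableAt hY.mdifferentiableAt

theorem IsLeviCivita.bracket_eq (hn : IsLeviCivita nabla) (hX : SmoothFieldAt X p)
    (hY : SmoothFieldAt Y p) : bracket X Y p = nabla Y p (X p) - nabla X p (Y p) :=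
  ((nabla.torsion_eq_zero_iff.1 hn.torsion_free) hX.mdifferentiableAt hY.mdifferentiableAt).symm

/-- If `⟪X, Y⟫` is locally constant, then `⟪∇_v X, Y⟫ = -⟪X, ∇_v Y⟫`. -/
theorem IsLeviCivita.inner_nabla_left (hn : IsLeviCivita nabla) (hX : SmoothFieldAt X p)
    (hY : SmoothFieldAt Y p) {c : ℝ} (h : ∀ᶠ q in 𝓝 p, ⟪X q, Y q⟫ = c)
    (v : TangentSpace (𝓡 3) p) : ⟪nabla X p v, Y p⟫ = -⟪X p, nabla Y p v⟫ := by
  have h1 := hn.mvfderiv_inner hX hY v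
  rw [mvfderiv_eq_zero_of_eventually_const h] at h1
  simp only [zero_apply] at h1
  linarith

theorem IsLeviCivita.inner_nabla_self (hn : IsLeviCivita nabla) (hX : SmoothFieldAt X p)
    {c : ℝ} (h : ∀ᶠ q in 𝓝 p, ⟪X q, X q⟫ = c) (v : TangentSpace (𝓡 3) p) :
    ⟪X p, nabla X p v⟫ = 0 := by
  have h1 := hn.inner_nabla_left hX hX h v
  rw [real_inner_comm] at h1
  linarith

end Connection

end

/-! ### The operator ∇ξ in a frame (ξ, e, φe). -/

section

namespace AlmostContactMetric

variable {M : Type*} [TopologicalSpace M] [ChartedSpace E3 M] [IsManifold (𝓡 3) ∞ M]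
  [RiemannianBundle (fun p : M ↦ TangentSpace (𝓡 3) p)] (S : AlmostContactMetric M)

/-- The field `e` is smooth on the open set `U`, of unit length and orthogonal to `ξ`. -/
structure IsUnitHorizontalOn (e : (p : M) → TangentSpace (𝓡 3) p) (U : Set M) : Prop where
  isOpen : IsOpen U
  smooth : ∀ q ∈ U, SmoothFieldAt e q
  unit : ∀ q ∈ U, ⟪e q, e q⟫ = 1
  horizontal : ∀ q ∈ U, S.eta q (e q) = 0

variable {S} {e : (p : M) → TangentSpace (𝓡 3) p} {U : Set M} {p : M}

theorem smoothFieldAt_xi (p : M) : SmoothFieldAt S.xi p := S.xi_smooth p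

theorem smoothFieldAt_phiField {X : (p : M) → TangentSpace (𝓡 3) p} (hX : SmoothFieldAt X p) :
    SmoothFieldAt (S.phiField X) p :=
  ContMDiffAt.clm_bundle_apply (S.phi_smooth p) hX

theorem smoothFieldAt_h' {X : (p : M) → TangentSpace (𝓡 3) p} (hX : SmoothFieldAt X p) :
    SmoothFieldAt (S.h' X) p := by
  have h1 := smoothFieldAt_phiField (S := S) (smoothFieldAt_phiField (S := S) hX)
  have h2 := (smoothFieldAt_xi (S := S) p).bracket h1
  have h3 := smoothFieldAt_phiField (S := S)
    ((smoothFieldAt_xi (S := S) p).bracket (smoothFieldAt_phiField (S := S) hX))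
  exact (h2.sub h3).const_smul (1 / 2 : ℝ)

theorem IsUnitHorizontalOn.mono {V : Set M} (he : S.IsUnitHorizontalOn e U) (hV : IsOpen V)
    (h : V ⊆ U) : S.IsUnitHorizontalOn e V :=
  ⟨hV, fun q hq ↦ he.smooth q (h hq), fun q hq ↦ he.unit q (h hq),
    fun q hq ↦ he.horizontal q (h hq)⟩

theorem IsUnitHorizontalOn.eventually (he : S.IsUnitHorizontalOn e U) (hp : p ∈ U)
    {P : M → Prop} (h : ∀ q ∈ U, P q) : ∀ᶠ q in 𝓝 p, P q := by
  filter_upwards [he.isOpen.mem_nhds hp] with q hq using h q hq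

theorem IsUnitHorizontalOn.phiField (he : S.IsUnitHorizontalOn e U) :
    S.IsUnitHorizontalOn (S.phiField e) U :=
  ⟨he.isOpen, fun q hq ↦ smoothFieldAt_phiField (he.smooth q hq),
    fun q hq ↦ by rw [AlmostContactMetric.phiField, S.inner_phi_phi (he.horizontal q hq),
      he.unit q hq], fun q _ ↦ S.eta_phi q _⟩

theorem IsUnitHorizontalOn.phi_phi (he : S.IsUnitHorizontalOn e U) :
    ∀ q ∈ U, S.phiField (S.phiField e) q = (-e) q :=
  fun q hq ↦ S.phi_phi (he.horizontal q hq)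

variable [IsContMDiffRiemannianBundle (𝓡 3) ∞ E3 (fun p : M ↦ TangentSpace (𝓡 3) p)]
  {nabla : CovariantDerivative (𝓡 3) E3 (fun p : M ↦ TangentSpace (𝓡 3) p)}

theorem eta_nabla_xi (hn : IsLeviCivita nabla) (v : TangentSpace (𝓡 3) p) :
    S.eta p (nabla S.xi p v) = 0 := by
  rw [eta_eq_inner]
  exact hn.inner_nabla_self (smoothFieldAt_xi p) (.of_forall fun q ↦ S.inner_xi_xi q) v

/-- For the Levi-Civita connection, dη(X, Y) = g(∇_X ξ, Y) - g(X, ∇_Y ξ). -/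
theorem nabla_xi_symm (hS : S.IsAlmostKenmotsu) (hn : IsLeviCivita nabla)
    (u v : TangentSpace (𝓡 3) p) : ⟪nabla S.xi p u, v⟫ = ⟪u, nabla S.xi p v⟫ := by
  obtain ⟨X, hX, rfl⟩ := exists_smoothFieldAt u
  obtain ⟨Y, hY, rfl⟩ := exists_smoothFieldAt v
  have h := hS.eta_closed X Y p hX hY
  have hxi := smoothFieldAt_xi (S := S) p
  simp only [extDerivOne, derivAlong, eta_eq_inner] at h
  rw [hn.mvfderiv_inner hxi hY, hn.mvfderiv_inner hxi hX, hn.bracket_eq hX hY, inner_sub_right] at h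
  rw [real_inner_comm _ (X p)]
  linarith

theorem nabla_xi_xi (hS : S.IsAlmostKenmotsu) (hn : IsLeviCivita nabla) :
    nabla S.xi p (S.xi p) = 0 := by
  refine ext_inner_right ℝ fun v ↦ ?_
  rw [nabla_xi_symm hS hn, ← eta_eq_inner, eta_nabla_xi hn, inner_zero_left]

theorem IsUnitHorizontalOn.inner_nabla_xi_left (he : S.IsUnitHorizontalOn e U)
    (hn : IsLeviCivita nabla) (hp : p ∈ U) (v : TangentSpace (𝓡 3) p) :
    S.eta p (nabla e p v) = -⟪e p, nabla S.xi p v⟫ := by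
  rw [eta_eq_inner, real_inner_comm]
  exact hn.inner_nabla_left (he.smooth p hp) (smoothFieldAt_xi p)
    (he.eventually hp fun q hq ↦ by rw [real_inner_comm, ← eta_eq_inner, he.horizontal q hq]) v

theorem IsUnitHorizontalOn.inner_nabla_self (he : S.IsUnitHorizontalOn e U)
    (hn : IsLeviCivita nabla) (hp : p ∈ U) (v : TangentSpace (𝓡 3) p) :
    ⟪e p, nabla e p v⟫ = 0 :=
  hn.inner_nabla_self (he.smooth p hp) (he.eventually hp he.unit) v

theorem IsUnitHorizontalOn.inner_nabla_phi (he : S.IsUnitHorizontalOn e U)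
    (hn : IsLeviCivita nabla) (hp : p ∈ U) (v : TangentSpace (𝓡 3) p) :
    ⟪e p, nabla (S.phiField e) p v⟫ = -⟪S.phi p (e p), nabla e p v⟫ := by
  rw [real_inner_comm]
  have := hn.inner_nabla_left (he.phiField.smooth p hp) (he.smooth p hp)
    (he.eventually hp fun q _ ↦ by
      rw [AlmostContactMetric.phiField, real_inner_comm, S.inner_phi_self]) v
  exact this

/-- The e-component vanishes because e has unit length, the ξ-component because ∇_ξ ξ = 0. Only a
rotation of the plane ker η is left. -/
theorem IsUnitHorizontalOn.nabla_xi_eq_zero (he : S.IsUnitHorizontalOn e U)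
    (hS : S.IsAlmostKenmotsu) (hn : IsLeviCivita nabla) (hp : p ∈ U) :
    nabla e p (S.xi p) = ⟪S.phi p (e p), nabla e p (S.xi p)⟫ • S.phi p (e p) := by
  conv_lhs => rw [S.frame_decomp (he.unit p hp) (he.horizontal p hp) (nabla e p (S.xi p)),
    he.inner_nabla_xi_left hn hp, nabla_xi_xi hS hn, he.inner_nabla_self hn hp]
  simp

/-- `∇ξ` has trace `2`. -/
theorem IsUnitHorizontalOn.trace_nabla_xi (he : S.IsUnitHorizontalOn e U)
    (hS : S.IsAlmostKenmotsu) (hn : IsLeviCivita nabla) (hp : p ∈ U) :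
    ⟪S.phi p (e p), nabla S.xi p (S.phi p (e p))⟫ = 2 - ⟪e p, nabla S.xi p (e p)⟫ := by
  have hxi := smoothFieldAt_xi (S := S) p
  have h := hS.d_fundForm S.xi e (S.phiField e) p hxi (he.smooth p hp) (he.phiField.smooth p hp)
  simp only [extDerivTwo, derivAlong, wedgeOneTwo, fundForm] at h
  -- The values Φ(e, φe) = -1, Φ(φe, ξ) = 0 and Φ(ξ, e) = 0 are constant, so only the bracket terms
  -- of dΦ(ξ, e, φe) survive; they add up to minus the trace, against 2(η∧Φ)(ξ, e, φe) = -2.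
  rw [mvfderiv_eq_zero_of_eventually_const (c := -1), mvfderiv_eq_zero_of_eventually_const (c := 0),
    mvfderiv_eq_zero_of_eventually_const (c := 0), hn.bracket_eq hxi (he.smooth p hp),
    hn.bracket_eq (he.phiField.smooth p hp) hxi, S.phi_xi, S.eta_xi, he.horizontal p hp] at h
  · have h1 : S.phi p (S.phiField e p) = -e p := he.phi_phi p hp
    have h2 := he.inner_nabla_self hn hp (S.xi p)
    have h3 := he.phiField.inner_nabla_self hn hp (S.xi p)
    have h4 := he.unit p hp
    simp only [AlmostContactMetric.phiField, eta_phi] at h h1 h2 h3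
    rw [h1] at h
    simp only [inner_sub_right, inner_neg_right, inner_zero_right, zero_apply,
      real_inner_comm (e p), real_inner_comm (S.phi p (e p)), h2, h3, h4] at h
    linarith
  · filter_upwards with q
    rw [← eta_eq_inner, eta_phi]
  · filter_upwards with q
    rw [phi_xi, inner_zero_right]
  · refine he.eventually hp fun q hq ↦ ?_
    have h1 : S.phi q (S.phiField e q) = -e q := he.phi_phi q hq
    rw [h1, inner_neg_right, he.unit q hq]

theorem IsUnitHorizontalOn.nabla_xi_self (he : S.IsUnitHorizontalOn e U)
    (hn : IsLeviCivita nabla) (hp : p ∈ U) :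
    nabla S.xi p (e p) = ⟪e p, nabla S.xi p (e p)⟫ • e p
      + ⟪S.phi p (e p), nabla S.xi p (e p)⟫ • S.phi p (e p) := by
  conv_lhs => rw [S.frame_decomp (he.unit p hp) (he.horizontal p hp) (nabla S.xi p (e p)),
    eta_nabla_xi hn]
  simp

theorem IsUnitHorizontalOn.nabla_xi_phi (he : S.IsUnitHorizontalOn e U)
    (hS : S.IsAlmostKenmotsu) (hn : IsLeviCivita nabla) (hp : p ∈ U) :
    nabla S.xi p (S.phi p (e p)) = ⟪S.phi p (e p), nabla S.xi p (e p)⟫ • e p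
      + (2 - ⟪e p, nabla S.xi p (e p)⟫) • S.phi p (e p) := by
  conv_lhs => rw [S.frame_decomp (he.unit p hp) (he.horizontal p hp)
    (nabla S.xi p (S.phi p (e p))), eta_nabla_xi hn, he.trace_nabla_xi hS hn hp,
    ← nabla_xi_symm hS hn, real_inner_comm]
  simp

/-- On horizontal fields, `h' = ∇ξ - 1`. -/
theorem IsUnitHorizontalOn.h'_eq (he : S.IsUnitHorizontalOn e U)
    (hS : S.IsAlmostKenmotsu) (hn : IsLeviCivita nabla) (hp : p ∈ U) :
    S.h' e p = nabla S.xi p (e p) - e p := by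
  have hxi := smoothFieldAt_xi (S := S) p
  have hf := he.phiField.smooth p hp
  have hff := smoothFieldAt_phiField (S := S) hf
  have h1 : nabla (S.phiField (S.phiField e)) p = -nabla e p := by
    rw [nabla_congr nabla (he.smooth p hp).neg (he.eventually hp he.phi_phi),
      nabla_neg nabla (he.smooth p hp)]
  have h2 := he.nabla_xi_eq_zero hS hn hp
  have h3 := he.phiField.nabla_xi_eq_zero hS hn hp
  have h4 := S.phi_phi (he.horizontal p hp)
  have h5 := he.nabla_xi_self hn hp
  have h6 := he.nabla_xi_phi hS hn hp
  have h7 := he.inner_nabla_phi hn hp (S.xi p)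
  simp only [h', h]
  rw [hn.bracket_eq hxi hff, hn.bracket_eq hxi hf, h1]
  simp only [AlmostContactMetric.phiField] at h3 h7 ⊢
  rw [h4, inner_neg_left, h7] at h3
  rw [h4]
  set a := ⟪e p, nabla S.xi p (e p)⟫
  set b := ⟪S.phi p (e p), nabla S.xi p (e p)⟫
  -- With ∇_ξ e = wφe and ∇_ξ(φe) = -we the w-terms cancel. Symmetry and trace 2 turn the remaining
  -- average into (a - 1)e + bφe.
  set w := ⟪S.phi p (e p), nabla e p (S.xi p)⟫
  simp only [neg_apply, map_neg, map_sub]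
  erw [h3]
  rw [h2, h5, h6]
  simp only [map_add, map_smul, h4, map_neg]
  module

end AlmostContactMetric

end

/-! ### The Riccati equation along ξ. -/

section

namespace AlmostContactMetric

variable {M : Type*} [TopologicalSpace M] [ChartedSpace E3 M] [IsManifold (𝓡 3) ∞ M]
  [RiemannianBundle (fun p : M ↦ TangentSpace (𝓡 3) p)] {S : AlmostContactMetric M}
  {e : (p : M) → TangentSpace (𝓡 3) p} {U : Set M} {p : M}
  [IsContMDiffRiemannianBundle (𝓡 3) ∞ E3 (fun p : M ↦ TangentSpace (𝓡 3) p)]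
  {nabla : CovariantDerivative (𝓡 3) E3 (fun p : M ↦ TangentSpace (𝓡 3) p)} {k μ : M → ℝ}

/-- Smoothness comes from h'e + e, which is built from brackets and φ, so no smoothness of the
connection itself has to be assumed. -/
theorem IsUnitHorizontalOn.smooth_nabla_xi (he : S.IsUnitHorizontalOn e U)
    (hS : S.IsAlmostKenmotsu) (hn : IsLeviCivita nabla) (hp : p ∈ U) :
    SmoothFieldAt (fun q ↦ nabla S.xi q (e q)) p := by
  refine ((smoothFieldAt_h' (S := S) (he.smooth p hp)).add (he.smooth p hp)).congr
    (he.eventually hp fun q hq ↦ ?_)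
  simp [he.h'_eq hS hn hq]

theorem IsUnitHorizontalOn.nabla_phi_xi (he : S.IsUnitHorizontalOn e U)
    (hS : S.IsAlmostKenmotsu) (hn : IsLeviCivita nabla) (hp : p ∈ U) :
    nabla (S.phiField e) p (S.xi p) = -⟪S.phi p (e p), nabla e p (S.xi p)⟫ • e p := by
  have h := he.phiField.nabla_xi_eq_zero hS hn hp
  have h1 : S.phi p (S.phiField e p) = -e p := he.phi_phi p hp
  rw [h1, inner_neg_left, he.inner_nabla_phi hn hp] at h
  rw [h]
  module

/-- This is R(e, ξ)ξ with ∇_ξ ξ = 0 and [e, ξ] = ∇_e ξ - ∇_ξ e inserted. The next two lemmas are its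
components along e and φe. -/
theorem IsUnitHorizontalOn.radial_curvature (he : S.IsUnitHorizontalOn e U)
    (hS : S.IsAlmostKenmotsu) (hn : IsLeviCivita nabla) (hnull : S.KMuPrimeNullity nabla k μ)
    (hp : p ∈ U) :
    nabla (fun q ↦ nabla S.xi q (e q)) p (S.xi p)
      + nabla S.xi p (nabla S.xi p (e p) - nabla e p (S.xi p))
      = -(k p • e p + μ p • (nabla S.xi p (e p) - e p)) := by
  have hxi := smoothFieldAt_xi (S := S) p
  have h := hnull e S.xi p (he.smooth p hp) hxi
  have h0 : (fun q ↦ nabla S.xi q (S.xi q)) = 0 := funext fun q ↦ nabla_xi_xi hS hn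
  rw [curvature, h0, nabla_zero, hn.bracket_eq (he.smooth p hp) hxi, S.eta_xi,
    he.horizontal p hp, he.h'_eq hS hn hp] at h
  simp only [zero_apply, one_smul, zero_smul, sub_zero, zero_sub] at h
  rw [← h]
  abel

theorem IsUnitHorizontalOn.radial_inner (he : S.IsUnitHorizontalOn e U)
    (hS : S.IsAlmostKenmotsu) (hn : IsLeviCivita nabla) (hnull : S.KMuPrimeNullity nabla k μ)
    (hp : p ∈ U) :
    mvfderiv (𝓡 3) (fun q ↦ ⟪e q, nabla S.xi q (e q)⟫) p (S.xi p)
      - 2 * ⟪S.phi p (e p), nabla e p (S.xi p)⟫ * ⟪S.phi p (e p), nabla S.xi p (e p)⟫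
      + (⟪e p, nabla S.xi p (e p)⟫ ^ 2 + ⟪S.phi p (e p), nabla S.xi p (e p)⟫ ^ 2)
      = -k p - μ p * (⟪e p, nabla S.xi p (e p)⟫ - 1) := by
  have h := congrArg (fun v ↦ ⟪e p, v⟫) (he.radial_curvature hS hn hnull hp)
  have h1 := he.nabla_xi_self hn hp
  have h2 := he.nabla_xi_phi hS hn hp
  have h4 := S.inner_phi_self p (e p)
  have h5 := he.unit p hp
  have h6 := he.nabla_xi_eq_zero hS hn hp
  rw [hn.mvfderiv_inner (he.smooth p hp) (he.smooth_nabla_xi hS hn hp)]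
  set a := ⟪e p, nabla S.xi p (e p)⟫
  set b := ⟪S.phi p (e p), nabla S.xi p (e p)⟫
  set w := ⟪S.phi p (e p), nabla e p (S.xi p)⟫
  rw [h6] at h ⊢
  have h7 : ⟪w • S.phi p (e p), nabla S.xi p (e p)⟫ = w * b := inner_smul_left_eq_smul _ _ _
  simp only [h1, h2, map_add, map_sub, map_smul, inner_add_right, inner_sub_right, inner_neg_right,
    real_inner_smul_right, h4, h5] at h
  rw [h7]
  linear_combination h

theorem IsUnitHorizontalOn.radial_inner_phi (he : S.IsUnitHorizontalOn e U)
    (hS : S.IsAlmostKenmotsu) (hn : IsLeviCivita nabla) (hnull : S.KMuPrimeNullity nabla k μ)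
    (hp : p ∈ U) :
    mvfderiv (𝓡 3) (fun q ↦ ⟪S.phi q (e q), nabla S.xi q (e q)⟫) p (S.xi p)
      + 2 * ⟪S.phi p (e p), nabla e p (S.xi p)⟫ * (⟪e p, nabla S.xi p (e p)⟫ - 1)
      + 2 * ⟪S.phi p (e p), nabla S.xi p (e p)⟫
      = -μ p * ⟪S.phi p (e p), nabla S.xi p (e p)⟫ := by
  have h := congrArg (fun v ↦ ⟪S.phi p (e p), v⟫) (he.radial_curvature hS hn hnull hp)
  have h1 := he.nabla_xi_self hn hp
  have h2 := he.nabla_xi_phi hS hn hp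
  have h4 : ⟪S.phi p (e p), e p⟫ = 0 := by rw [real_inner_comm, S.inner_phi_self p (e p)]
  have h5 : ⟪S.phi p (e p), S.phi p (e p)⟫ = 1 := he.phiField.unit p hp
  have h6 := he.nabla_xi_eq_zero hS hn hp
  have h8 := hn.mvfderiv_inner (he.phiField.smooth p hp) (he.smooth_nabla_xi hS hn hp) (S.xi p)
  rw [he.nabla_phi_xi hS hn hp] at h8
  simp only [AlmostContactMetric.phiField] at h8
  rw [h8]
  set a := ⟪e p, nabla S.xi p (e p)⟫
  set b := ⟪S.phi p (e p), nabla S.xi p (e p)⟫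
  set w := ⟪S.phi p (e p), nabla e p (S.xi p)⟫
  rw [h6] at h
  have h7 : ⟪-w • e p, nabla S.xi p (e p)⟫ = -w * a := inner_smul_left_eq_smul _ _ _
  simp only [h1, h2, map_add, map_sub, map_smul, inner_add_right, inner_sub_right, inner_neg_right,
    real_inner_smul_right, h4, h5] at h
  rw [h7]
  linear_combination h

/-- The eigenvalues of `h'` on horizontal vectors are `±√(-1 - k)`. -/
theorem IsUnitHorizontalOn.sq_add_sq (he : S.IsUnitHorizontalOn e U)
    (hS : S.IsAlmostKenmotsu) (hn : IsLeviCivita nabla) (hnull : S.KMuPrimeNullity nabla k μ)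
    (hp : p ∈ U) :
    (⟪e p, nabla S.xi p (e p)⟫ - 1) ^ 2 + ⟪S.phi p (e p), nabla S.xi p (e p)⟫ ^ 2
      = -1 - k p := by
  have h1 := he.radial_inner hS hn hnull hp
  -- Passing from e to φe replaces a by 2 - a and b by -b and keeps w. Hence the derivative, w and μ
  -- terms are all opposite, and half the sum of the two equations is the claim.
  have h2 := he.phiField.radial_inner hS hn hnull hp
  have h3 : S.phi p (S.phiField e p) = -e p := he.phi_phi p hp
  have h4 : mvfderiv (𝓡 3) (fun q ↦ ⟪S.phiField e q, nabla S.xi q (S.phiField e q)⟫) p (S.xi p)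
      = -mvfderiv (𝓡 3) (fun q ↦ ⟪e q, nabla S.xi q (e q)⟫) p (S.xi p) := by
    simp only [AlmostContactMetric.phiField]
    rw [mvfderiv_congr (he.eventually hp fun q hq ↦ he.trace_nabla_xi hS hn hq)]
    have hd := ((he.smooth p hp).inner (he.smooth_nabla_xi hS hn hp)).mdifferentiableAt (by simp)
    rw [mvfderiv_fun_sub mdifferentiableAt_const hd, mvfderiv_const]
    simp
  rw [h4, h3] at h2
  simp only [AlmostContactMetric.phiField] at h2
  have h5 := he.inner_nabla_phi hn hp (S.xi p)
  have h6 : ⟪e p, nabla S.xi p (S.phi p (e p))⟫ = ⟪S.phi p (e p), nabla S.xi p (e p)⟫ := by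
    rw [← nabla_xi_symm hS hn, real_inner_comm]
  rw [inner_neg_left, inner_neg_left, he.trace_nabla_xi hS hn hp, h5, h6] at h2
  linear_combination (h1 + h2) / 2

end AlmostContactMetric

end

/-! ### A local smooth eigenfield of h'. -/

section

namespace AlmostContactMetric

variable {M : Type*} [TopologicalSpace M] [ChartedSpace E3 M] [IsManifold (𝓡 3) ∞ M]
  [RiemannianBundle (fun p : M ↦ TangentSpace (𝓡 3) p)] {S : AlmostContactMetric M}
  {e : (p : M) → TangentSpace (𝓡 3) p} {U : Set M} {p : M}
  [IsContMDiffRiemannianBundle (𝓡 3) ∞ E3 (fun p : M ↦ TangentSpace (𝓡 3) p)]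
  {nabla : CovariantDerivative (𝓡 3) E3 (fun p : M ↦ TangentSpace (𝓡 3) p)} {k μ : M → ℝ}

/-- A horizontal field which is smooth near `p` and nonzero at `p` can be normalized near `p`. -/
theorem exists_normalization {W : (p : M) → TangentSpace (𝓡 3) p}
    (hW : ∀ᶠ q in 𝓝 p, SmoothFieldAt W q) (h0 : ∀ᶠ q in 𝓝 p, S.eta q (W q) = 0)
    (hp : W p ≠ 0) :
    ∃ (e : (p : M) → TangentSpace (𝓡 3) p) (U : Set M), p ∈ U ∧ S.IsUnitHorizontalOn e U ∧
      ∀ q ∈ U, e q = (√⟪W q, W q⟫)⁻¹ • W q := by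
  have hpos : ∀ᶠ q in 𝓝 p, 0 < ⟪W q, W q⟫ :=
    ((hW.self_of_nhds.inner hW.self_of_nhds).continuousAt).eventually_const_lt
      (real_inner_self_pos.2 hp)
  obtain ⟨U, hU, hUo, hpU⟩ := eventually_nhds_iff.1 (hW.and (h0.and hpos))
  refine ⟨fun q ↦ (√⟪W q, W q⟫)⁻¹ • W q, U, hpU, ⟨hUo, fun q hq ↦ ?_, fun q hq ↦ ?_,
    fun q hq ↦ ?_⟩, fun q _ ↦ rfl⟩
  · obtain ⟨h1, -, h3⟩ := hU q hq
    have hN := h1.inner h1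
    have : ContDiffAt ℝ ∞ (fun x : ℝ ↦ (√x)⁻¹) ⟪W q, W q⟫ :=
      (Real.contDiffAt_sqrt h3.ne').inv (Real.sqrt_ne_zero'.2 h3)
    exact SmoothFieldAt.smul (ContDiffAt.comp_contMDiffAt (f := fun q ↦ ⟪W q, W q⟫) this hN) h1
  · obtain ⟨-, -, h3⟩ := hU q hq
    rw [real_inner_smul_left, real_inner_smul_right, ← mul_assoc, ← mul_inv,
      Real.mul_self_sqrt h3.le, inv_mul_cancel₀ h3.ne']
  · rw [map_smul, (hU q hq).2.1, smul_zero]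

theorem contMDiffAt_eta {X : (p : M) → TangentSpace (𝓡 3) p} (hX : SmoothFieldAt X p) :
    ContMDiffAt (𝓡 3) 𝓘(ℝ, ℝ) ∞ (fun q ↦ S.eta q (X q)) p := by
  simp only [eta_eq_inner]
  exact (smoothFieldAt_xi p).inner hX

variable (S) in
theorem exists_isUnitHorizontalOn (p : M) :
    ∃ (e : (p : M) → TangentSpace (𝓡 3) p) (U : Set M), p ∈ U ∧ S.IsUnitHorizontalOn e U := by
  obtain ⟨v, hv0, hv⟩ : ∃ v : TangentSpace (𝓡 3) p, v ≠ 0 ∧ S.eta p v = 0 := by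
    have : FiniteDimensional ℝ (TangentSpace (𝓡 3) p) :=
      inferInstanceAs (FiniteDimensional ℝ E3)
    have h3 : Module.finrank ℝ (TangentSpace (𝓡 3) p) = 3 := by
      change Module.finrank ℝ E3 = 3
      simp
    have h := LinearMap.ker_ne_bot_of_finrank_lt (f := (S.eta p).toLinearMap) (by simp [h3])
    obtain ⟨v, hv, hv0⟩ := Submodule.exists_mem_ne_zero_of_ne_bot h
    exact ⟨v, hv0, hv⟩
  obtain ⟨V, hV, hVp⟩ := exists_smoothFieldAt_nhds v
  obtain ⟨e, U, hpU, he, -⟩ := exists_normalization (S := S) (p := p)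
    (W := V - (fun q ↦ S.eta q (V q)) • S.xi)
    (by
      filter_upwards [hV] with q hq
      exact hq.sub (SmoothFieldAt.smul (contMDiffAt_eta hq) (smoothFieldAt_xi q)))
    (.of_forall fun q ↦ by simp [S.eta_xi]) (by simpa [hVp, hv] using hv0)
  exact ⟨e, U, hpU, he⟩

variable (S) in
/-- `e` is a unit horizontal field on `U` with `h' e = √(-1 - k) e`. -/
structure IsEigenfieldOn (nabla : CovariantDerivative (𝓡 3) E3 (fun p : M ↦ TangentSpace (𝓡 3) p))
    (k : M → ℝ) (e : (p : M) → TangentSpace (𝓡 3) p) (U : Set M) : Prop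
    extends S.IsUnitHorizontalOn e U where
  eigen : ∀ q ∈ U, nabla S.xi q (e q) = (1 + √(-1 - k q)) • e q

omit [IsManifold (𝓡 3) ∞ M] [RiemannianBundle (fun p : M ↦ TangentSpace (𝓡 3) p)]
  [IsContMDiffRiemannianBundle (𝓡 3) ∞ E3 (fun p : M ↦ TangentSpace (𝓡 3) p)] in
theorem contMDiffAt_sqrt (hk : ContMDiff (𝓡 3) 𝓘(ℝ, ℝ) ∞ k) (hk_lt : ∀ p, k p < -1) (p : M) :
    ContMDiffAt (𝓡 3) 𝓘(ℝ, ℝ) ∞ (fun q ↦ √(-1 - k q)) p := by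
  have h1 : -1 - k p ≠ 0 := by linarith [hk_lt p]
  exact ContDiffAt.comp_contMDiffAt (f := fun q ↦ -1 - k q) (Real.contDiffAt_sqrt h1)
    (contMDiffAt_const.sub (hk p))

/-- Since (h')² = λ² on ker η, the operator h' + λ maps ker η into the λ-eigenspace of h'. So W =
(h' + λ)e is a smooth eigenfield wherever it is nonzero, and it only has to be normalized. -/
theorem exists_isEigenfieldOn (hS : S.IsAlmostKenmotsu) (hn : IsLeviCivita nabla)
    (hnull : S.KMuPrimeNullity nabla k μ) (hk : ContMDiff (𝓡 3) 𝓘(ℝ, ℝ) ∞ k)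
    (hk_lt : ∀ p, k p < -1) (p : M) :
    ∃ (X : (p : M) → TangentSpace (𝓡 3) p) (U : Set M), p ∈ U ∧
      S.IsEigenfieldOn nabla k X U := by
  -- By trace 2, one of e and φe satisfies g(e, ∇_e ξ) ≥ 1 at p. This makes the e-component a - 1 +
  -- λ of W positive at p.
  obtain ⟨e, U, hp, he, hge⟩ : ∃ (e : (p : M) → TangentSpace (𝓡 3) p) (U : Set M), p ∈ U ∧
      S.IsUnitHorizontalOn e U ∧ 1 ≤ ⟪e p, nabla S.xi p (e p)⟫ := by
    obtain ⟨e, U, hp, he⟩ := S.exists_isUnitHorizontalOn p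
    rcases le_total 1 ⟪e p, nabla S.xi p (e p)⟫ with h | h
    · exact ⟨e, U, hp, he, h⟩
    · refine ⟨S.phiField e, U, hp, he.phiField, ?_⟩
      have := he.trace_nabla_xi hS hn hp
      simp only [phiField]
      linarith
  let W : (p : M) → TangentSpace (𝓡 3) p :=
    (fun q ↦ ⟪e q, nabla S.xi q (e q)⟫ - 1 + √(-1 - k q)) • e
      + (fun q ↦ ⟪S.phiField e q, nabla S.xi q (e q)⟫) • S.phiField e
  have hWs (q) (hq : q ∈ U) : SmoothFieldAt W q := by
    have h1 := he.smooth q hq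
    have h2 := he.smooth_nabla_xi hS hn hq
    have h3 := he.phiField.smooth q hq
    exact (SmoothFieldAt.smul (((h1.inner h2).sub contMDiffAt_const).add
      (contMDiffAt_sqrt hk hk_lt q)) h1).add (SmoothFieldAt.smul (h3.inner h2) h3)
  have hWh (q) (hq : q ∈ U) : S.eta q (W q) = 0 := by
    simp [W, he.horizontal q hq, phiField, S.eta_phi]
  have hWp : W p ≠ 0 := by
    intro h
    have h1 := congrArg (fun v ↦ ⟪e p, v⟫) h
    simp only [W, phiField, Pi.add_apply, Pi.smul_apply', inner_add_right, real_inner_smul_right,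
      he.unit p hp, S.inner_phi_self, inner_zero_right] at h1
    have : 0 < √(-1 - k p) := Real.sqrt_pos.2 (by linarith [hk_lt p])
    linarith
  have hWe (q) (hq : q ∈ U) : nabla S.xi q (W q) = (1 + √(-1 - k q)) • W q := by
    have h1 := he.nabla_xi_self hn hq
    have h2 := he.nabla_xi_phi hS hn hq
    have h3 := he.sq_add_sq hS hn hnull hq
    have h4 : √(-1 - k q) ^ 2 = -1 - k q := Real.sq_sqrt (by linarith [hk_lt q])
    simp only [W, phiField, Pi.add_apply, Pi.smul_apply', map_add, map_smul]
    set a := ⟪e q, nabla S.xi q (e q)⟫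
    set b := ⟪S.phi q (e q), nabla S.xi q (e q)⟫
    set l := √(-1 - k q)
    rw [h1, h2]
    have h5 : b ^ 2 = l ^ 2 - (a - 1) ^ 2 := by linarith
    have h6 : (a - 1 + l) * a + b * b = (1 + l) * (a - 1 + l) := by linear_combination h5
    have h7 : (a - 1 + l) * b + b * (2 - a) = (1 + l) * b := by ring
    calc (a - 1 + l) • (a • e q + b • S.phi q (e q)) + b • (b • e q + (2 - a) • S.phi q (e q))
        = ((a - 1 + l) * a + b * b) • e q
          + ((a - 1 + l) * b + b * (2 - a)) • S.phi q (e q) := by module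
      _ = _ := by rw [h6, h7]; module
  obtain ⟨X, V, hpV, hX, hXW⟩ := exists_normalization (S := S)
    (he.eventually hp hWs) (he.eventually hp hWh) hWp
  refine ⟨X, U ∩ V, ⟨hp, hpV⟩, hX.mono (he.isOpen.inter hX.isOpen) Set.inter_subset_right,
    fun q hq ↦ ?_⟩
  rw [hXW q hq.2, map_smul, hWe q hq.1, smul_comm]

end AlmostContactMetric

end

/-! ### The connection in the eigenframe. -/

section

namespace AlmostContactMetric

variable {M : Type*} [TopologicalSpace M] [ChartedSpace E3 M] [IsManifold (𝓡 3) ∞ M]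
  [RiemannianBundle (fun p : M ↦ TangentSpace (𝓡 3) p)] {S : AlmostContactMetric M}
  {X : (p : M) → TangentSpace (𝓡 3) p} {U : Set M} {p : M}
  [IsContMDiffRiemannianBundle (𝓡 3) ∞ E3 (fun p : M ↦ TangentSpace (𝓡 3) p)]
  {nabla : CovariantDerivative (𝓡 3) E3 (fun p : M ↦ TangentSpace (𝓡 3) p)} {k μ : M → ℝ}

omit [IsContMDiffRiemannianBundle (𝓡 3) ∞ E3 (fun p : M ↦ TangentSpace (𝓡 3) p)] in
theorem mvfderiv_eq_eta_mul (hdk : ∀ (p : M) (u v : TangentSpace (𝓡 3) p),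
      wedgeOneOne (mvfderiv (𝓡 3) k p) (S.eta p) u v = 0) (v : TangentSpace (𝓡 3) p) :
    mvfderiv (𝓡 3) k p v = S.eta p v * mvfderiv (𝓡 3) k p (S.xi p) := by
  have := hdk p v (S.xi p)
  rw [wedgeOneOne, S.eta_xi] at this
  linarith

omit [IsManifold (𝓡 3) ∞ M] [RiemannianBundle (fun p : M ↦ TangentSpace (𝓡 3) p)]
  [IsContMDiffRiemannianBundle (𝓡 3) ∞ E3 (fun p : M ↦ TangentSpace (𝓡 3) p)] in
theorem mvfderiv_eq_sqrt_mul (hk : ContMDiff (𝓡 3) 𝓘(ℝ, ℝ) ∞ k) (hk_lt : ∀ p, k p < -1) (p : M)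
    (v : TangentSpace (𝓡 3) p) :
    mvfderiv (𝓡 3) k p v
      = -(2 * √(-1 - k p) * mvfderiv (𝓡 3) (fun q ↦ √(-1 - k q)) p v) := by
  have h1 := (contMDiffAt_sqrt hk hk_lt p).mdifferentiableAt (by simp)
  have h2 := (hk p).mdifferentiableAt (by simp)
  have h3 : mvfderiv (𝓡 3) (fun q ↦ √(-1 - k q) * √(-1 - k q)) p
      = mvfderiv (𝓡 3) (fun q ↦ -1 - k q) p :=
    mvfderiv_congr (.of_forall fun q ↦ Real.mul_self_sqrt (by linarith [hk_lt q]))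
  rw [mvfderiv_fun_mul h1 h1, mvfderiv_fun_sub mdifferentiableAt_const h2, mvfderiv_const] at h3
  have h4 := congrArg (fun L ↦ L v) h3
  simp at h4
  linarith

omit [IsContMDiffRiemannianBundle (𝓡 3) ∞ E3 (fun p : M ↦ TangentSpace (𝓡 3) p)] in
theorem mvfderiv_sqrt_eq_eta_mul (hk : ContMDiff (𝓡 3) 𝓘(ℝ, ℝ) ∞ k) (hk_lt : ∀ p, k p < -1)
    (hdk : ∀ (p : M) (u v : TangentSpace (𝓡 3) p),
      wedgeOneOne (mvfderiv (𝓡 3) k p) (S.eta p) u v = 0) (v : TangentSpace (𝓡 3) p) :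
    mvfderiv (𝓡 3) (fun q ↦ √(-1 - k q)) p v
      = S.eta p v * mvfderiv (𝓡 3) (fun q ↦ √(-1 - k q)) p (S.xi p) := by
  have h1 := mvfderiv_eq_eta_mul hdk v
  rw [mvfderiv_eq_sqrt_mul hk hk_lt p v, mvfderiv_eq_sqrt_mul hk hk_lt p (S.xi p)] at h1
  have h2 : √(-1 - k p) ≠ 0 := Real.sqrt_ne_zero'.2 (by linarith [hk_lt p])
  apply mul_left_cancel₀ h2
  linarith

namespace IsEigenfieldOn

omit [IsContMDiffRiemannianBundle (𝓡 3) ∞ E3 (fun p : M ↦ TangentSpace (𝓡 3) p)] in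
theorem inner_nabla_xi (hX : S.IsEigenfieldOn nabla k X U) (hp : p ∈ U) :
    ⟪X p, nabla S.xi p (X p)⟫ = 1 + √(-1 - k p) := by
  rw [hX.eigen p hp, real_inner_smul_right, hX.unit p hp, mul_one]

omit [IsContMDiffRiemannianBundle (𝓡 3) ∞ E3 (fun p : M ↦ TangentSpace (𝓡 3) p)] in
theorem inner_phi_nabla_xi (hX : S.IsEigenfieldOn nabla k X U) (hp : p ∈ U) :
    ⟪S.phi p (X p), nabla S.xi p (X p)⟫ = 0 := by
  rw [hX.eigen p hp, real_inner_smul_right, real_inner_comm, S.inner_phi_self, mul_zero]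

theorem eigen_phi (hX : S.IsEigenfieldOn nabla k X U) (hS : S.IsAlmostKenmotsu)
    (hn : IsLeviCivita nabla) (hp : p ∈ U) :
    nabla S.xi p (S.phi p (X p)) = (1 - √(-1 - k p)) • S.phi p (X p) := by
  rw [hX.nabla_xi_phi hS hn hp, hX.inner_nabla_xi hp, hX.inner_phi_nabla_xi hp]
  module

/-- The off-diagonal Riccati equation with b = 0 and a - 1 = λ reduces to 2wλ = 0. So X does not
rotate along ξ. -/
theorem nabla_xi_dir (hX : S.IsEigenfieldOn nabla k X U) (hS : S.IsAlmostKenmotsu)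
    (hn : IsLeviCivita nabla) (hnull : S.KMuPrimeNullity nabla k μ) (hk_lt : ∀ p, k p < -1)
    (hp : p ∈ U) : ⟪S.phi p (X p), nabla X p (S.xi p)⟫ = 0 := by
  have h := hX.radial_inner_phi hS hn hnull hp
  rw [mvfderiv_eq_zero_of_eventually_const
    (hX.eventually hp fun q hq ↦ hX.inner_phi_nabla_xi hq), hX.inner_phi_nabla_xi hp,
    hX.inner_nabla_xi hp, zero_apply] at h
  have h2 : √(-1 - k p) ≠ 0 := Real.sqrt_ne_zero'.2 (by linarith [hk_lt p])
  apply mul_left_cancel₀ h2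
  linarith

/-- The diagonal Riccati equation with a = 1 + λ and b = 0 reads ξ(λ) + (1 + λ)² = -k - μλ; then λ²
= -1 - k is used. -/
theorem mvfderiv_sqrt_xi (hX : S.IsEigenfieldOn nabla k X U) (hS : S.IsAlmostKenmotsu)
    (hn : IsLeviCivita nabla) (hnull : S.KMuPrimeNullity nabla k μ)
    (hk : ContMDiff (𝓡 3) 𝓘(ℝ, ℝ) ∞ k) (hk_lt : ∀ p, k p < -1) (hp : p ∈ U) :
    mvfderiv (𝓡 3) (fun q ↦ √(-1 - k q)) p (S.xi p) = -(√(-1 - k p) * (μ p + 2)) := by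
  have h := hX.radial_inner hS hn hnull hp
  have h1 := (contMDiffAt_sqrt hk hk_lt p).mdifferentiableAt (by simp)
  rw [mvfderiv_congr (hX.eventually hp fun q hq ↦ hX.inner_nabla_xi hq),
    mvfderiv_fun_add mdifferentiableAt_const h1, mvfderiv_const, zero_add,
    hX.inner_phi_nabla_xi hp, hX.inner_nabla_xi hp] at h
  have h4 : √(-1 - k p) ^ 2 = -1 - k p := Real.sq_sqrt (by linarith [hk_lt p])
  linear_combination h - h4

theorem mvfderiv_xi (hX : S.IsEigenfieldOn nabla k X U) (hS : S.IsAlmostKenmotsu)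
    (hn : IsLeviCivita nabla) (hnull : S.KMuPrimeNullity nabla k μ)
    (hk : ContMDiff (𝓡 3) 𝓘(ℝ, ℝ) ∞ k) (hk_lt : ∀ p, k p < -1) (hp : p ∈ U) :
    mvfderiv (𝓡 3) k p (S.xi p) = -(2 * (k p + 1) * (μ p + 2)) := by
  rw [mvfderiv_eq_sqrt_mul hk hk_lt, hX.mvfderiv_sqrt_xi hS hn hnull hk hk_lt hp]
  have h4 : √(-1 - k p) ^ 2 = -1 - k p := Real.sq_sqrt (by linarith [hk_lt p])
  linear_combination 2 * (μ p + 2) * h4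

/-- The leaves of `ker η` are flat. -/
theorem nabla_leaf (hX : S.IsEigenfieldOn nabla k X U) (hS : S.IsAlmostKenmotsu)
    (hn : IsLeviCivita nabla) (hnull : S.KMuPrimeNullity nabla k μ)
    (hk : ContMDiff (𝓡 3) 𝓘(ℝ, ℝ) ∞ k) (hk_lt : ∀ p, k p < -1)
    (hdk : ∀ (p : M) (u v : TangentSpace (𝓡 3) p),
      wedgeOneOne (mvfderiv (𝓡 3) k p) (S.eta p) u v = 0) (hp : p ∈ U) :
    ⟪S.phi p (X p), nabla X p (X p)⟫ = 0 ∧ ⟪S.phi p (X p), nabla X p (S.phi p (X p))⟫ = 0 := by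
  have hXs := hX.smooth p hp
  have hYs := hX.phiField.smooth p hp
  have hl := contMDiffAt_sqrt hk hk_lt p
  have hlX : mvfderiv (𝓡 3) (fun q ↦ √(-1 - k q)) p (X p) = 0 := by
    rw [mvfderiv_sqrt_eq_eta_mul hk hk_lt hdk, hX.horizontal p hp, zero_mul]
  have hlY : mvfderiv (𝓡 3) (fun q ↦ √(-1 - k q)) p (S.phi p (X p)) = 0 := by
    rw [mvfderiv_sqrt_eq_eta_mul hk hk_lt hdk, S.eta_phi, zero_mul]
  have h1 : nabla (fun q ↦ nabla S.xi q (X q)) p (S.phi p (X p))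
      = (1 + √(-1 - k p)) • nabla X p (S.phi p (X p)) := by
    rw [nabla_congr (X := (fun q ↦ 1 + √(-1 - k q)) • X) nabla
      (SmoothFieldAt.smul (contMDiffAt_const.add hl) hXs) (hX.eventually hp hX.eigen),
      nabla_smul (f := fun q ↦ 1 + √(-1 - k q)) nabla (contMDiffAt_const.add hl) hXs,
      mvfderiv_fun_add mdifferentiableAt_const (hl.mdifferentiableAt (by simp)), mvfderiv_const,
      zero_add, hlY, zero_smul, add_zero]
  have h2 : nabla (fun q ↦ nabla S.xi q (S.phiField X q)) p (X p)
      = (1 - √(-1 - k p)) • nabla (S.phiField X) p (X p) := by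
    rw [nabla_congr (X := (fun q ↦ 1 - √(-1 - k q)) • S.phiField X)
      (Y := fun q ↦ nabla S.xi q (S.phiField X q)) nabla
      (SmoothFieldAt.smul (contMDiffAt_const.sub hl) hYs)
      (hX.eventually hp fun q hq ↦ hX.eigen_phi hS hn hq),
      nabla_smul (f := fun q ↦ 1 - √(-1 - k q)) nabla (contMDiffAt_const.sub hl) hYs,
      mvfderiv_fun_sub mdifferentiableAt_const (hl.mdifferentiableAt (by simp)), mvfderiv_const,
      zero_sub, neg_apply, hlX, neg_zero, zero_smul, add_zero]
  -- Both fields are horizontal, so R(X, φX)ξ = 0. As λ is constant along ker η, its X- and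
  -- φX-components are the two rotation coefficients of the frame, each times the eigenvalue gap 2λ
  -- up to sign.
  have h := hnull X (S.phiField X) p hXs hYs
  have h3 : S.phiField X p = S.phi p (X p) := rfl
  rw [curvature, h2, h3, h1, hn.bracket_eq hXs hYs, h3, S.eta_phi, hX.horizontal p hp] at h
  simp only [zero_smul, sub_zero, smul_zero, add_zero] at h
  have hA (u : TangentSpace (𝓡 3) p) := nabla_xi_symm hS hn (X p) u
  have hB (u : TangentSpace (𝓡 3) p) := nabla_xi_symm hS hn (S.phi p (X p)) u
  rw [hX.eigen p hp] at hA
  rw [hX.eigen_phi hS hn hp] at hB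
  have hXh := congrArg (fun v ↦ ⟪X p, v⟫) h
  have hYh := congrArg (fun v ↦ ⟪S.phi p (X p), v⟫) h
  have i1 := hX.inner_nabla_phi hn hp (X p)
  have i2 := hX.inner_nabla_self hn hp (S.phi p (X p))
  have i3 : ⟪S.phi p (X p), nabla (S.phiField X) p (X p)⟫ = 0 :=
    hX.phiField.inner_nabla_self hn hp (X p)
  have h5 : √(-1 - k p) ≠ 0 := Real.sqrt_ne_zero'.2 (by linarith [hk_lt p])
  simp only [inner_sub_right, real_inner_smul_right, real_inner_smul_left, ← hA, ← hB, i1, i2, i3,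
    inner_zero_right] at hXh hYh
  constructor <;> apply mul_left_cancel₀ h5 <;> linarith

/-- The φX-component vanishes in all three frame directions by `nabla_xi_dir` and `nabla_leaf`, the
X-component by unit length. The ξ-component is -g(X, ∇_v ξ), known from the eigenvalue. -/
theorem nabla_eq (hX : S.IsEigenfieldOn nabla k X U) (hS : S.IsAlmostKenmotsu)
    (hn : IsLeviCivita nabla) (hnull : S.KMuPrimeNullity nabla k μ)
    (hk : ContMDiff (𝓡 3) 𝓘(ℝ, ℝ) ∞ k) (hk_lt : ∀ p, k p < -1)
    (hdk : ∀ (p : M) (u v : TangentSpace (𝓡 3) p),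
      wedgeOneOne (mvfderiv (𝓡 3) k p) (S.eta p) u v = 0) (hp : p ∈ U)
    (v : TangentSpace (𝓡 3) p) :
    nabla X p v = -((1 + √(-1 - k p)) * ⟪X p, v⟫) • S.xi p := by
  have h0 : ⟪S.phi p (X p), nabla X p v⟫ = 0 := by
    obtain ⟨h1, h2⟩ := hX.nabla_leaf hS hn hnull hk hk_lt hdk hp
    rw [S.frame_decomp (hX.unit p hp) (hX.horizontal p hp) v]
    simp only [map_add, map_smul, inner_add_right, real_inner_smul_right, h1, h2,
      hX.nabla_xi_dir hS hn hnull hk_lt hp, mul_zero, add_zero]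
  rw [S.frame_decomp (hX.unit p hp) (hX.horizontal p hp) (nabla X p v),
    hX.inner_nabla_xi_left hn hp, hX.inner_nabla_self hn hp, h0, ← nabla_xi_symm hS hn,
    hX.eigen p hp, real_inner_smul_left]
  module

theorem nabla_phi_eq (hX : S.IsEigenfieldOn nabla k X U) (hS : S.IsAlmostKenmotsu)
    (hn : IsLeviCivita nabla) (hnull : S.KMuPrimeNullity nabla k μ)
    (hk : ContMDiff (𝓡 3) 𝓘(ℝ, ℝ) ∞ k) (hk_lt : ∀ p, k p < -1)
    (hdk : ∀ (p : M) (u v : TangentSpace (𝓡 3) p),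
      wedgeOneOne (mvfderiv (𝓡 3) k p) (S.eta p) u v = 0) (hp : p ∈ U)
    (v : TangentSpace (𝓡 3) p) :
    nabla (S.phiField X) p v = -((1 - √(-1 - k p)) * ⟪S.phi p (X p), v⟫) • S.xi p := by
  have h0 : ⟪X p, nabla (S.phiField X) p v⟫ = 0 := by
    rw [hX.inner_nabla_phi hn hp, hX.nabla_eq hS hn hnull hk hk_lt hdk hp, real_inner_smul_right,
      real_inner_comm (S.xi p), ← eta_eq_inner, S.eta_phi, mul_zero, neg_zero]
  have h1 : ⟪S.phi p (X p), nabla (S.phiField X) p v⟫ = 0 := hX.phiField.inner_nabla_self hn hp v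
  have h2 : S.phiField X p = S.phi p (X p) := rfl
  rw [S.frame_decomp (hX.unit p hp) (hX.horizontal p hp) (nabla (S.phiField X) p v),
    hX.phiField.inner_nabla_xi_left hn hp, h0, h1, ← nabla_xi_symm hS hn, h2,
    hX.eigen_phi hS hn hp, real_inner_smul_left]
  module

end IsEigenfieldOn

end AlmostContactMetric

end

/-! ### Charts, constant fields and the Poincaré lemma. -/

section

variable {M : Type*} [TopologicalSpace M] [ChartedSpace E3 M] [IsManifold (𝓡 3) ∞ M]

section ConstField

variable {Ψ : OpenPartialHomeomorph M E3} {q : M}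

/-- The vector field which is constant, equal to `v`, in the chart `Ψ`. -/
def constField (Ψ : OpenPartialHomeomorph M E3) (v : E3) : (p : M) → TangentSpace (𝓡 3) p :=
  VectorField.mpullback (𝓡 3) 𝓘(ℝ, E3) Ψ (fun _ ↦ v)

omit [IsManifold (𝓡 3) ∞ M] in
theorem mdifferentiable_of_mem_maximalAtlas (hΨ : Ψ ∈ IsManifold.maximalAtlas (𝓡 3) ∞ M) :
    Ψ.MDifferentiable (𝓡 3) 𝓘(ℝ, E3) :=
  ⟨(contMDiffOn_of_mem_maximalAtlas hΨ).mdifferentiableOn (by simp),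
    (contMDiffOn_symm_of_mem_maximalAtlas hΨ).mdifferentiableOn (by simp)⟩

omit [IsManifold (𝓡 3) ∞ M] in
theorem isInvertible_mfderiv (hΨ : Ψ ∈ IsManifold.maximalAtlas (𝓡 3) ∞ M) (hq : q ∈ Ψ.source) :
    (mfderiv (𝓡 3) 𝓘(ℝ, E3) Ψ q).IsInvertible :=
  ⟨(mdifferentiable_of_mem_maximalAtlas hΨ).mfderiv hq, rfl⟩

omit [IsManifold (𝓡 3) ∞ M] in
theorem mfderiv_constField (hΨ : Ψ ∈ IsManifold.maximalAtlas (𝓡 3) ∞ M) (hq : q ∈ Ψ.source)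
    (v : E3) : mfderiv (𝓡 3) 𝓘(ℝ, E3) Ψ q (constField Ψ v q) = v :=
  (isInvertible_mfderiv hΨ hq).self_apply_inverse v

omit [IsManifold (𝓡 3) ∞ M] in
theorem eq_constField (hΨ : Ψ ∈ IsManifold.maximalAtlas (𝓡 3) ∞ M) (hq : q ∈ Ψ.source)
    {v : E3} {u : TangentSpace (𝓡 3) q} (h : mfderiv (𝓡 3) 𝓘(ℝ, E3) Ψ q u = v) :
    u = constField Ψ v q :=
  ((mdifferentiable_of_mem_maximalAtlas hΨ).mfderiv_injective hq)
    (h.trans (mfderiv_constField hΨ hq v).symm)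

theorem smoothFieldAt_constField (hΨ : Ψ ∈ IsManifold.maximalAtlas (𝓡 3) ∞ M)
    (hq : q ∈ Ψ.source) (v : E3) : SmoothFieldAt (constField Ψ v) q := by
  refine ContMDiffAt.mpullback_vectorField_preimage (n := ∞) ?_
    (contMDiffAt_of_mem_maximalAtlas hΨ hq) (isInvertible_mfderiv hΨ hq) (by simp)
  exact contMDiffAt_vectorSpace_iff_contDiffAt.2 contDiffAt_const

theorem mlieBracket_const (u v x : E3) :
    VectorField.mlieBracket 𝓘(ℝ, E3) (fun _ ↦ u) (fun _ ↦ v) x = 0 := by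
  refine (congrFun VectorField.mlieBracketWithin_univ.symm x).trans
    ((congrFun VectorField.mlieBracketWithin_eq_lieBracketWithin x).trans ?_)
  simp [VectorField.lieBracketWithin]
  rfl

theorem bracket_constField (hΨ : Ψ ∈ IsManifold.maximalAtlas (𝓡 3) ∞ M)
    (hq : q ∈ Ψ.source) (u v : E3) : bracket (constField Ψ u) (constField Ψ v) q = 0 := by
  have hc (w : E3) : MDifferentiableAt 𝓘(ℝ, E3) (𝓘(ℝ, E3).prod 𝓘(ℝ, E3))
      (fun x ↦ (⟨x, w⟩ : TangentBundle 𝓘(ℝ, E3) E3)) (Ψ q) := by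
    have h : ContMDiffAt 𝓘(ℝ, E3) (𝓘(ℝ, E3).prod 𝓘(ℝ, E3)) 1
        (fun x ↦ (⟨x, w⟩ : TangentBundle 𝓘(ℝ, E3) E3)) (Ψ q) :=
      contMDiffAt_vectorSpace_iff_contDiffAt.2 contDiffAt_const
    exact h.mdifferentiableAt (by simp)
  have : IsManifold (𝓡 3) (minSmoothness ℝ 2) M := by
    rw [minSmoothness_of_isRCLikeNormedField]
    infer_instance
  have : IsManifold 𝓘(ℝ, E3) (minSmoothness ℝ 2) E3 := by
    rw [minSmoothness_of_isRCLikeNormedField]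
    infer_instance
  have h2 : minSmoothness ℝ 2 ≤ (∞ : WithTop ℕ∞) := by
    rw [minSmoothness_of_isRCLikeNormedField]
    exact ENat.LEInfty.out
  have := VectorField.mpullback_mlieBracket (n := ∞) (hc u) (hc v)
    (contMDiffAt_of_mem_maximalAtlas hΨ hq) h2
  rw [bracket, constField, constField, ← this, VectorField.mpullback_apply]
  exact (congrArg _ (mlieBracket_const u v (Ψ q))).trans (map_zero _)

omit [IsManifold (𝓡 3) ∞ M] in
theorem mvfderiv_eq_fderiv (hΨ : Ψ ∈ IsManifold.maximalAtlas (𝓡 3) ∞ M) (hq : q ∈ Ψ.source)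
    {f : M → ℝ} (hf : ContMDiffAt (𝓡 3) 𝓘(ℝ, ℝ) ∞ f q) (u : TangentSpace (𝓡 3) q) :
    mvfderiv (𝓡 3) f q u
      = fderiv ℝ (f ∘ Ψ.symm) (Ψ q) (mfderiv (𝓡 3) 𝓘(ℝ, E3) Ψ q u) := by
  have hd := mdifferentiable_of_mem_maximalAtlas hΨ
  have h1 : ∀ᶠ r in 𝓝 q, f r = ((f ∘ Ψ.symm) ∘ Ψ) r := by
    filter_upwards [Ψ.open_source.mem_nhds hq] with r hr
    simp [Ψ.left_inv hr]
  have h2 : MDifferentiableAt 𝓘(ℝ, E3) 𝓘(ℝ, ℝ) (f ∘ Ψ.symm) (Ψ q) :=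
    MDifferentiableAt.comp (Ψ q) (by
      rw [Ψ.left_inv hq]
      exact hf.mdifferentiableAt (by simp)) (hd.mdifferentiableAt_symm (Ψ.map_source hq))
  rw [mvfderiv_congr h1, mvfderiv_comp_apply q h2 (hd.mdifferentiableAt hq)]
  simp only [mvfderiv, mfderiv_eq_fderiv]
  rfl

end ConstField

/-- The Poincaré lemma: closed `1`-forms are locally exact. -/
theorem exists_primitive {α : (q : M) → TangentSpace (𝓡 3) q →L[ℝ] ℝ} {U : Set M} {p : M}
    (hU : IsOpen U) (hp : p ∈ U)
    (hα : ∀ q ∈ U, ∀ V : (q : M) → TangentSpace (𝓡 3) q, SmoothFieldAt V q →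
      ContMDiffAt (𝓡 3) 𝓘(ℝ, ℝ) ∞ (fun r ↦ α r (V r)) q)
    (hd : ∀ q ∈ U, ∀ V W : (q : M) → TangentSpace (𝓡 3) q, SmoothFieldAt V q →
      SmoothFieldAt W q → extDerivOne (fun r v ↦ α r v) V W q = 0) :
    ∃ (f : M → ℝ) (V : Set M), IsOpen V ∧ p ∈ V ∧ V ⊆ U ∧
      ∀ q ∈ V, ContMDiffAt (𝓡 3) 𝓘(ℝ, ℝ) ∞ f q ∧ mvfderiv (𝓡 3) f q = α q := by
  let c := chartAt E3 p
  have hc : c ∈ IsManifold.maximalAtlas (𝓡 3) ∞ M := IsManifold.chart_mem_maximalAtlas p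
  have hpc : p ∈ c.source := mem_chart_source E3 p
  have hT : IsOpen (c.target ∩ c.symm ⁻¹' U) := c.isOpen_inter_preimage_symm hU
  have hpT : c p ∈ c.target ∩ c.symm ⁻¹' U :=
    ⟨c.map_source hpc, by simpa [c.left_inv hpc] using hp⟩
  obtain ⟨r, hr, hrT⟩ := Metric.isOpen_iff.1 hT _ hpT
  -- This is α read in the chart `c`. Fields constant in the chart commute, so closedness of α
  -- becomes symmetry of the derivative of `β`, and on the convex ball `β` has a primitive.
  let β : E3 → E3 →L[ℝ] ℝ := fun x ↦
    (α (c.symm x)).comp (mfderiv (𝓡 3) 𝓘(ℝ, E3) c (c.symm x)).inverse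
  have hβ (x v : E3) : β x v = α (c.symm x) (constField c v (c.symm x)) := rfl
  have hsm (x : E3) (hx : x ∈ c.target ∩ c.symm ⁻¹' U) (v : E3) :
      ContMDiffAt (𝓡 3) 𝓘(ℝ, ℝ) ∞ (fun q ↦ α q (constField c v q)) (c.symm x) :=
    hα _ hx.2 _ (smoothFieldAt_constField hc (c.map_target hx.1) v)
  have hβs : ContDiffOn ℝ ∞ β (Metric.ball (c p) r) := by
    rw [contDiffOn_clm_apply]
    intro v x hx
    have h1 : ContMDiffAt 𝓘(ℝ, E3) 𝓘(ℝ, ℝ) ∞ ((fun q ↦ α q (constField c v q)) ∘ c.symm) x :=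
      ContMDiffAt.comp x (hsm x (hrT hx) v) (contMDiffAt_symm_of_mem_maximalAtlas hc (hrT hx).1)
    exact h1.contDiffAt.contDiffWithinAt
  have hβd : DifferentiableOn ℝ β (Metric.ball (c p) r) := hβs.differentiableOn (by simp)
  have hfd (x : E3) (hx : x ∈ Metric.ball (c p) r) (u v : E3) : fderiv ℝ β x u v
      = derivAlong (constField c u) (fun q ↦ α q (constField c v q)) (c.symm x) := by
    have h1 := mvfderiv_eq_fderiv hc (c.map_target (hrT hx).1) (hsm x (hrT hx) v)
      (constField c u (c.symm x))
    rw [mfderiv_constField hc (c.map_target (hrT hx).1), c.right_inv (hrT hx).1] at h1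
    rw [derivAlong, h1]
    have h2 := (hβd x hx).differentiableAt (Metric.isOpen_ball.mem_nhds hx)
    have h3 := (h2.hasFDerivAt.clm_apply (hasFDerivAt_const v x)).fderiv
    have h4 : (fun q ↦ α q (constField c v q)) ∘ c.symm = fun x ↦ β x v := rfl
    rw [h4, h3]
    simp
  obtain ⟨F, hF⟩ := (convex_ball (c p) r).exists_forall_hasFDerivAt_of_fderiv_symmetric
    Metric.isOpen_ball hβd fun x hx u v ↦ by
      have hs := c.map_target (hrT hx).1
      have := hd _ (hrT hx).2 _ _ (smoothFieldAt_constField hc hs u)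
        (smoothFieldAt_constField hc hs v)
      rw [extDerivOne, bracket_constField hc hs, map_zero, sub_zero, sub_eq_zero] at this
      rw [hfd x hx, hfd x hx, this]
  have hFs : ContDiffOn ℝ ∞ F (Metric.ball (c p) r) := by
    rw [contDiffOn_infty_iff_fderiv_of_isOpen Metric.isOpen_ball]
    exact ⟨fun x hx ↦ (hF x hx).differentiableAt.differentiableWithinAt,
      hβs.congr fun x hx ↦ (hF x hx).fderiv⟩
  refine ⟨F ∘ c, c.source ∩ c ⁻¹' Metric.ball (c p) r,
    c.isOpen_inter_preimage Metric.isOpen_ball, ⟨hpc, Metric.mem_ball_self hr⟩, fun q hq ↦ ?_,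
    fun q hq ↦ ?_⟩
  · simpa [c.left_inv hq.1] using (hrT hq.2).2
  · have hs : ContMDiffAt (𝓡 3) 𝓘(ℝ, ℝ) ∞ (F ∘ c) q :=
      ContDiffAt.comp_contMDiffAt
        (hFs.contDiffAt (Metric.isOpen_ball.mem_nhds hq.2))
        (contMDiffAt_of_mem_maximalAtlas hc hq.1)
    refine ⟨hs, ?_⟩
    ext u
    have h1 : (F ∘ c) ∘ c.symm =ᶠ[𝓝 (c q)] F := by
      filter_upwards [c.open_target.mem_nhds (c.map_source hq.1)] with x hx
      simp [c.right_inv hx]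
    rw [mvfderiv_eq_fderiv hc hq.1 hs, h1.fderiv_eq, (hF _ hq.2).fderiv]
    refine (hβ _ _).trans ?_
    rw [c.left_inv hq.1, ← eq_constField hc hq.1 rfl]

end

/-! ### The coordinate functions attached to X and φX. -/

section

namespace AlmostContactMetric

variable {M : Type*} [TopologicalSpace M] [ChartedSpace E3 M] [IsManifold (𝓡 3) ∞ M]
  [RiemannianBundle (fun p : M ↦ TangentSpace (𝓡 3) p)] {S : AlmostContactMetric M}
  {X : (p : M) → TangentSpace (𝓡 3) p} {U : Set M} {p : M}
  [IsContMDiffRiemannianBundle (𝓡 3) ∞ E3 (fun p : M ↦ TangentSpace (𝓡 3) p)]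
  {nabla : CovariantDerivative (𝓡 3) E3 (fun p : M ↦ TangentSpace (𝓡 3) p)} {c : M → ℝ}

/-- The form cη is closed: dc is a multiple of η, so dc ∧ η = 0, and dη = 0. -/
theorem exists_primitive_smul_eta (hS : S.IsAlmostKenmotsu) (hU : IsOpen U) (hp : p ∈ U)
    (hc : ∀ q ∈ U, ContMDiffAt (𝓡 3) 𝓘(ℝ, ℝ) ∞ c q)
    (hdc : ∀ q ∈ U, ∀ v, mvfderiv (𝓡 3) c q v = S.eta q v * mvfderiv (𝓡 3) c q (S.xi q)) :
    ∃ (f : M → ℝ) (V : Set M), IsOpen V ∧ p ∈ V ∧ V ⊆ U ∧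
      ∀ q ∈ V, ContMDiffAt (𝓡 3) 𝓘(ℝ, ℝ) ∞ f q ∧ mvfderiv (𝓡 3) f q = c q • S.eta q := by
  refine exists_primitive hU hp (fun q hq V hV ↦ (hc q hq).mul (contMDiffAt_eta hV))
    fun q hq V W hV hW ↦ ?_
  have h := hS.eta_closed V W q hV hW
  have h1 := hdc q hq
  have h2 := (hc q hq).mdifferentiableAt (by simp)
  have h3 := (contMDiffAt_eta (S := S) hV).mdifferentiableAt (by simp)
  have h4 := (contMDiffAt_eta (S := S) hW).mdifferentiableAt (by simp)
  simp only [extDerivOne, derivAlong, smul_apply, smul_eq_mul] at h ⊢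
  rw [mvfderiv_fun_mul h2 h4, mvfderiv_fun_mul h2 h3]
  simp only [add_apply, smul_apply, smul_eq_mul, h1 (V q), h1 (W q)]
  linear_combination c q * h

/-- The hypothesis on ∇X gives dX♭ = cη ∧ X♭. With dG = cη, the form e^{-G}X♭ is therefore closed,
say equal to dw, and f = e^G w satisfies df = X♭ + fcη. -/
theorem exists_coordinate (hS : S.IsAlmostKenmotsu) (hn : IsLeviCivita nabla) (hU : IsOpen U)
    (hp : p ∈ U) (hX : ∀ q ∈ U, SmoothFieldAt X q)
    (hc : ∀ q ∈ U, ContMDiffAt (𝓡 3) 𝓘(ℝ, ℝ) ∞ c q)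
    (hdc : ∀ q ∈ U, ∀ v, mvfderiv (𝓡 3) c q v = S.eta q v * mvfderiv (𝓡 3) c q (S.xi q))
    (hXc : ∀ q ∈ U, ∀ v, nabla X q v = -(c q * ⟪X q, v⟫) • S.xi q) :
    ∃ (f : M → ℝ) (V : Set M), IsOpen V ∧ p ∈ V ∧ V ⊆ U ∧
      ∀ q ∈ V, ContMDiffAt (𝓡 3) 𝓘(ℝ, ℝ) ∞ f q ∧
        ∀ v, mvfderiv (𝓡 3) f q v = ⟪X q, v⟫ + f q * c q * S.eta q v := by
  obtain ⟨G, V, hV, hpV, hVU, hG⟩ := exists_primitive_smul_eta hS hU hp hc hdc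
  have hexp {g : M → ℝ} {q : M} (hg : ContMDiffAt (𝓡 3) 𝓘(ℝ, ℝ) ∞ g q) :
      ContMDiffAt (𝓡 3) 𝓘(ℝ, ℝ) ∞ (fun r ↦ Real.exp (g r)) q :=
    Real.contDiff_exp.contDiffAt.comp_contMDiffAt hg
  have hdexp {g : M → ℝ} {q : M} (hg : ContMDiffAt (𝓡 3) 𝓘(ℝ, ℝ) ∞ g q)
      (v : TangentSpace (𝓡 3) q) :
      mvfderiv (𝓡 3) (fun r ↦ Real.exp (g r)) q v = Real.exp (g q) * mvfderiv (𝓡 3) g q v := by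
    have h1 : MDifferentiableAt 𝓘(ℝ, ℝ) 𝓘(ℝ, ℝ) Real.exp (g q) :=
      Real.differentiableAt_exp.mdifferentiableAt
    have h2 := mvfderiv_comp_apply q h1 (hg.mdifferentiableAt (by simp)) v
    have h3 (t w : ℝ) : mvfderiv 𝓘(ℝ, ℝ) Real.exp t w = Real.exp t * w := by
      simp only [mvfderiv, mfderiv_eq_fderiv]
      change fderiv ℝ Real.exp t w = Real.exp t * w
      rw [fderiv_eq_smul_deriv, Real.deriv_exp, smul_eq_mul, mul_comm]
    exact h2.trans (h3 _ _)
  obtain ⟨w, W, hW, hpW, hWV, hw⟩ := exists_primitive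
    (α := fun q ↦ Real.exp (-G q) • innerSL ℝ (X q)) hV hpV
    (fun q hq Y hY ↦ (hexp (hG q hq).1.neg).mul ((hX q (hVU hq)).inner hY))
    fun q hq Y Z hY hZ ↦ by
      have hXq := hX q (hVU hq)
      have h0 := hexp (hG q hq).1.neg
      have h1 (v) := hdexp (hG q hq).1.neg v
      simp only [extDerivOne, derivAlong, smul_apply, smul_eq_mul, innerSL_apply_apply]
      rw [mvfderiv_fun_mul (h0.mdifferentiableAt (by simp))
        ((hXq.inner hZ).mdifferentiableAt (by simp)),
        mvfderiv_fun_mul (h0.mdifferentiableAt (by simp))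
        ((hXq.inner hY).mdifferentiableAt (by simp)), hn.bracket_eq hY hZ]
      simp only [add_apply, smul_apply, smul_eq_mul, h1, hn.mvfderiv_inner hXq hZ,
        hn.mvfderiv_inner hXq hY, mvfderiv_fun_neg, neg_apply, (hG q hq).2, hXc q (hVU hq),
        inner_sub_right, real_inner_smul_left, ← eta_eq_inner]
      ring
  refine ⟨fun q ↦ Real.exp (G q) * w q, W, hW, hpW, hWV.trans hVU, fun q hq ↦
    ⟨(hexp (hG q (hWV hq)).1).mul (hw q hq).1, fun v ↦ ?_⟩⟩
  rw [mvfderiv_fun_mul ((hexp (hG q (hWV hq)).1).mdifferentiableAt (by simp))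
    ((hw q hq).1.mdifferentiableAt (by simp))]
  simp only [add_apply, smul_apply, smul_eq_mul, hdexp (hG q (hWV hq)).1, (hG q (hWV hq)).2,
    (hw q hq).2, innerSL_apply_apply]
  rw [← mul_assoc, ← Real.exp_add, add_neg_cancel, Real.exp_zero]
  ring

end AlmostContactMetric

end

/-! ### Charts from the inverse function theorem. -/

section

variable {M : Type*} [TopologicalSpace M] [ChartedSpace E3 M] [IsManifold (𝓡 3) ∞ M]

/-- The inverse function theorem: a smooth map with injective differentials restricts to a chart
whose target is a ball. -/
theorem exists_chart {F : M → E3} {V : Set M} {p : M} (hV : IsOpen V) (hp : p ∈ V)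
    (hF : ∀ q ∈ V, ContMDiffAt (𝓡 3) 𝓘(ℝ, E3) ∞ F q)
    (hinj : ∀ q ∈ V, Function.Injective (mfderiv (𝓡 3) 𝓘(ℝ, E3) F q)) :
    ∃ Ψ ∈ IsManifold.maximalAtlas (𝓡 3) ∞ M, p ∈ Ψ.source ∧ Ψ.source ⊆ V ∧
      (∀ q ∈ Ψ.source, Ψ q = F q) ∧ ∃ r, Ψ.target = Metric.ball (F p) r := by
  let c := chartAt E3 p
  have hc : c ∈ IsManifold.maximalAtlas (𝓡 3) ∞ M := IsManifold.chart_mem_maximalAtlas p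
  have hpc : p ∈ c.source := mem_chart_source E3 p
  have hT : IsOpen (c.target ∩ c.symm ⁻¹' V) := c.isOpen_inter_preimage_symm hV
  have hpT : c p ∈ c.target ∩ c.symm ⁻¹' V :=
    ⟨c.map_source hpc, by simpa [c.left_inv hpc] using hp⟩
  have hg (x : E3) (hx : x ∈ c.target ∩ c.symm ⁻¹' V) : ContDiffAt ℝ ∞ (F ∘ c.symm) x :=
    (ContMDiffAt.comp x (hF _ hx.2) (contMDiffAt_symm_of_mem_maximalAtlas hc hx.1)).contDiffAt
  have hg' (x : E3) (hx : x ∈ c.target ∩ c.symm ⁻¹' V) :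
      ∃ L : E3 ≃L[ℝ] E3, HasFDerivAt (F ∘ c.symm) (L : E3 →L[ℝ] E3) x := by
    have h1 : mfderiv 𝓘(ℝ, E3) 𝓘(ℝ, E3) (F ∘ c.symm) x = _ :=
      mfderiv_comp x ((hF _ hx.2).mdifferentiableAt (by simp))
        ((mdifferentiable_of_mem_maximalAtlas hc).mdifferentiableAt_symm hx.1)
    have h2 : Function.Injective (fderiv ℝ (F ∘ c.symm) x) := by
      rw [← mfderiv_eq_fderiv, h1]
      exact (hinj _ hx.2).comp
        ((mdifferentiable_of_mem_maximalAtlas hc).symm.mfderiv_injective hx.1)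
    refine ⟨(LinearEquiv.ofInjectiveEndo (fderiv ℝ (F ∘ c.symm) x : E3 →ₗ[ℝ] E3)
      h2).toContinuousLinearEquiv, ?_⟩
    exact ((hg x hx).differentiableAt (by simp)).hasFDerivAt
  obtain ⟨L, hL⟩ := hg' _ hpT
  let I := ((hg _ hpT).toOpenPartialHomeomorph (F ∘ c.symm) hL (by simp)).restrOpen _ hT
  let Φ := c.trans I
  have hpΦ : p ∈ Φ.source := by
    simp only [Φ, OpenPartialHomeomorph.trans_source]
    exact ⟨hpc, (hg _ hpT).mem_toOpenPartialHomeomorph_source hL (by simp), hpT⟩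
  have hΦ (q : M) (hq : q ∈ Φ.source) : q ∈ c.source ∧ q ∈ V ∧ Φ q = F q := by
    simp only [Φ, OpenPartialHomeomorph.trans_source] at hq
    have hq2 : c q ∈ c.target ∩ c.symm ⁻¹' V := hq.2.2
    have h : c.symm (c q) = q := c.left_inv hq.1
    exact ⟨hq.1, by simpa [h] using hq2.2, congrArg F h⟩
  obtain ⟨r, hr, hrT⟩ := Metric.isOpen_iff.1 Φ.open_target _ (Φ.map_source hpΦ)
  -- Restricting the inverse makes the target a ball. The later argument that μ depends on one
  -- coordinate only runs inside this ball.
  let Ψ := (Φ.symm.restrOpen (Metric.ball (Φ p) r) Metric.isOpen_ball).symm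
  have hΨs (q : M) (hq : q ∈ Ψ.source) : q ∈ Φ.source := by
    have := Ψ.map_source hq
    have h2 : Ψ q ∈ Φ.target := this.1
    have h3 := Φ.map_target h2
    rwa [show Φ.symm (Ψ q) = q from Ψ.left_inv hq] at h3
  have hΨt : Ψ.target = Metric.ball (F p) r := by
    rw [← (hΦ p hpΦ).2.2]
    exact Set.inter_eq_right.2 hrT
  refine ⟨Ψ, Ψ.mem_maximalAtlas_of_contMDiffOn ?_ ?_, ?_, fun q hq ↦ (hΦ q (hΨs q hq)).2.1,
    fun q hq ↦ (hΦ q (hΨs q hq)).2.2, r, hΨt⟩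
  · intro q hq
    refine ContMDiffWithinAt.congr (f := F)
      (hF q (hΦ q (hΨs q hq)).2.1).contMDiffWithinAt
      (fun s hs ↦ (hΦ s (hΨs s hs)).2.2) (hΦ q (hΨs q hq)).2.2
  · intro x hx
    have hxΦ : x ∈ Φ.target := hx.1
    have hxI : x ∈ I.target := hxΦ.1
    have hy : I.symm x ∈ c.target ∩ c.symm ⁻¹' V := (I.map_target hxI).2
    obtain ⟨L, hL⟩ := hg' _ hy
    have h1 : ContDiffAt ℝ ∞ I.symm x := I.contDiffAt_symm hxI hL (hg _ hy)
    exact (ContMDiffAt.comp x (contMDiffAt_symm_of_mem_maximalAtlas hc hy.1)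
      h1.contMDiffAt).contMDiffWithinAt
  · have h1 : Ψ.symm (Φ p) ∈ Ψ.source :=
      Ψ.map_target ⟨Φ.map_source hpΦ, Metric.mem_ball_self hr⟩
    rwa [show Ψ.symm (Φ p) = p from Φ.left_inv hpΦ] at h1

omit [IsManifold (𝓡 3) ∞ M] in
theorem contMDiffAt_vec {x y z : M → ℝ} {q : M} (hx : ContMDiffAt (𝓡 3) 𝓘(ℝ, ℝ) ∞ x q)
    (hy : ContMDiffAt (𝓡 3) 𝓘(ℝ, ℝ) ∞ y q) (hz : ContMDiffAt (𝓡 3) 𝓘(ℝ, ℝ) ∞ z q) :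
    ContMDiffAt (𝓡 3) 𝓘(ℝ, E3) ∞ (fun q ↦ (!₂[x q, y q, z q] : E3)) q := by
  have h : ContMDiffAt (𝓡 3) 𝓘(ℝ, Fin 3 → ℝ) ∞ (fun q ↦ ![x q, y q, z q]) q := by
    rw [contMDiffAt_pi_space]
    intro i
    fin_cases i <;> assumption
  exact (EuclideanSpace.equiv (Fin 3) ℝ).symm.contDiff.contDiffAt.comp_contMDiffAt h

omit [IsManifold (𝓡 3) ∞ M] in
theorem mfderiv_apply {F : M → E3} {q : M} (hF : ContMDiffAt (𝓡 3) 𝓘(ℝ, E3) ∞ F q)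
    (u : TangentSpace (𝓡 3) q) (i : Fin 3) :
    (EuclideanSpace.proj i : E3 →L[ℝ] ℝ) (mfderiv (𝓡 3) 𝓘(ℝ, E3) F q u) = mvfderiv (𝓡 3) (fun r ↦ F r i) q u := by
  let L : E3 →L[ℝ] ℝ := EuclideanSpace.proj i
  have h1 (t w : E3) : mvfderiv 𝓘(ℝ, E3) L t w = L w := by
    simp only [mvfderiv, mfderiv_eq_fderiv]
    change fderiv ℝ L t w = L w
    rw [L.fderiv]
  have h2 := mvfderiv_comp_apply (f := F) (g := L) q L.mdifferentiableAt
    (hF.mdifferentiableAt (by simp)) u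
  exact ((h2.trans (h1 _ _)).symm)

end

/-! ### The adapted chart and the dependence of μ on z. -/

section

/-- Each point of the ball is joined, inside the ball, to the point `σ (y 2)` of the vertical axis
through the centre at the same height. The segment is horizontal, so g is constant on it, and m is g
restricted to the axis. -/
theorem exists_eq_of_fderiv_eq_zero {g : E3 → ℝ} {y₀ : E3} {r : ℝ}
    (hg : ∀ y ∈ Metric.ball y₀ r, ContDiffAt ℝ ∞ g y)
    (h0 : ∀ y ∈ Metric.ball y₀ r, fderiv ℝ g y (EuclideanSpace.single 0 1) = 0)
    (h1 : ∀ y ∈ Metric.ball y₀ r, fderiv ℝ g y (EuclideanSpace.single 1 1) = 0) :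
    ∃ m : ℝ → ℝ, ContDiffOn ℝ ∞ m ((fun y : E3 ↦ y 2) '' Metric.ball y₀ r) ∧
      ∀ y ∈ Metric.ball y₀ r, g y = m (y 2) := by
  let σ : ℝ → E3 := fun z ↦ y₀ + (z - y₀ 2) • EuclideanSpace.single 2 1
  have hσ (y : E3) (hy : y ∈ Metric.ball y₀ r) : σ (y 2) ∈ Metric.ball y₀ r := by
    rw [mem_ball_iff_norm] at hy ⊢
    refine lt_of_le_of_lt ?_ hy
    have := PiLp.norm_apply_le (y - y₀) 2
    simpa [σ, norm_smul] using this
  have hσs : ContDiff ℝ ∞ σ := by fun_prop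
  refine ⟨g ∘ σ, ?_, fun y hy ↦ ?_⟩
  · rintro z ⟨y, hy, rfl⟩
    exact (ContDiffAt.comp (y 2) (hg _ (hσ y hy)) hσs.contDiffAt).contDiffWithinAt
  · let γ : ℝ → E3 := fun t ↦ σ (y 2) + t • (y - σ (y 2))
    have hγ (t : ℝ) (ht : t ∈ Set.Icc (0 : ℝ) 1) : γ t ∈ Metric.ball y₀ r :=
      (convex_ball y₀ r).add_smul_sub_mem (hσ y hy) hy ht
    have hw : y - σ (y 2) = (y 0 - y₀ 0) • EuclideanSpace.single 0 (1 : ℝ)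
        + (y 1 - y₀ 1) • EuclideanSpace.single 1 (1 : ℝ) := by
      ext i
      fin_cases i <;> simp [σ]
    have hd (t : ℝ) (ht : t ∈ Set.Icc (0 : ℝ) 1) : HasDerivAt (g ∘ γ) 0 t := by
      have h2 : HasDerivAt γ (y - σ (y 2)) t := by
        simpa [γ] using ((hasDerivAt_id t).smul_const (y - σ (y 2))).const_add (σ (y 2))
      have h3 := ((hg _ (hγ t ht)).differentiableAt (by simp)).hasFDerivAt.comp_hasDerivAt t h2
      rwa [hw, map_add, map_smul, map_smul, h0 _ (hγ t ht), h1 _ (hγ t ht), smul_zero, smul_zero,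
        add_zero] at h3
    have h4 := constant_of_has_deriv_right_zero
      (fun t ht ↦ (hd t ht).continuousAt.continuousWithinAt)
      (fun t ht ↦ (hd t ⟨ht.1, ht.2.le⟩).hasDerivWithinAt) 1 (Set.right_mem_Icc.2 zero_le_one)
    simpa [γ] using h4

namespace AlmostContactMetric

variable {M : Type*} [TopologicalSpace M] [ChartedSpace E3 M] [IsManifold (𝓡 3) ∞ M]
  [RiemannianBundle (fun p : M ↦ TangentSpace (𝓡 3) p)] {S : AlmostContactMetric M}
  {X : (p : M) → TangentSpace (𝓡 3) p} {U : Set M} {p : M}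
  [IsContMDiffRiemannianBundle (𝓡 3) ∞ E3 (fun p : M ↦ TangentSpace (𝓡 3) p)]
  {nabla : CovariantDerivative (𝓡 3) E3 (fun p : M ↦ TangentSpace (𝓡 3) p)} {k μ : M → ℝ}

/-- The chart is (x, y, k), with x and y from `exists_coordinate` for X, c = 1 + λ and for φX, c = 1
- λ. The components of a vector are its values under dx, dy, dk, which are known on X, φX and ξ. -/
theorem IsEigenfieldOn.exists_adapted_chart (hX : S.IsEigenfieldOn nabla k X U)
    (hS : S.IsAlmostKenmotsu) (hn : IsLeviCivita nabla) (hnull : S.KMuPrimeNullity nabla k μ)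
    (hk : ContMDiff (𝓡 3) 𝓘(ℝ, ℝ) ∞ k) (hk_lt : ∀ p, k p < -1)
    (hdk : ∀ (p : M) (u v : TangentSpace (𝓡 3) p),
      wedgeOneOne (mvfderiv (𝓡 3) k p) (S.eta p) u v = 0)
    (hμ : ∀ p, μ p ≠ -2) (hp : p ∈ U) :
    ∃ Ψ ∈ IsManifold.maximalAtlas (𝓡 3) ∞ M, p ∈ Ψ.source ∧ Ψ.source ⊆ U ∧
      (∃ y r, Ψ.target = Metric.ball y r) ∧ ∀ q ∈ Ψ.source, k q = Ψ q 2 ∧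
        X q = coordField Ψ 0 q ∧ S.phi q (X q) = coordField Ψ 1 q ∧
        S.xi q = (Ψ q 0 * (1 + √(-1 - k q))) • coordField Ψ 0 q
          + (Ψ q 1 * (1 - √(-1 - k q))) • coordField Ψ 1 q
          - (2 * (k q + 1) * (μ q + 2)) • coordField Ψ 2 q := by
  have hl := contMDiffAt_sqrt hk hk_lt
  have hld (q : M) := (hl q).mdifferentiableAt (by simp)
  obtain ⟨x, V, hV, hpV, hVU, hx⟩ := exists_coordinate (c := fun q ↦ 1 + √(-1 - k q)) hS hn
    hX.isOpen hp hX.smooth (fun q _ ↦ contMDiffAt_const.add (hl q))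
    (fun q _ v ↦ by
      rw [mvfderiv_fun_add mdifferentiableAt_const (hld q), mvfderiv_const, zero_add]
      exact mvfderiv_sqrt_eq_eta_mul hk hk_lt hdk v)
    (fun q hq v ↦ hX.nabla_eq hS hn hnull hk hk_lt hdk hq v)
  obtain ⟨y, W, hW, hpW, hWV, hy⟩ := exists_coordinate (c := fun q ↦ 1 - √(-1 - k q)) hS hn
    hV hpV (fun q hq ↦ hX.phiField.smooth q (hVU hq)) (fun q _ ↦ contMDiffAt_const.sub (hl q))
    (fun q _ v ↦ by
      rw [mvfderiv_fun_sub mdifferentiableAt_const (hld q), mvfderiv_const, zero_sub, neg_apply,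
        neg_apply, mvfderiv_sqrt_eq_eta_mul hk hk_lt hdk v, mul_neg])
    (fun q hq v ↦ hX.nabla_phi_eq hS hn hnull hk hk_lt hdk (hVU hq) v)
  have hz (q : M) (hq : q ∈ U) (v : TangentSpace (𝓡 3) q) :
      mvfderiv (𝓡 3) k q v = S.eta q v * -(2 * (k q + 1) * (μ q + 2)) := by
    rw [mvfderiv_eq_eta_mul hdk, hX.mvfderiv_xi hS hn hnull hk hk_lt hq]
  have hF (q : M) (hq : q ∈ W) := contMDiffAt_vec (hx q (hWV hq)).1 (hy q hq).1 (hk q)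
  have hFd (q : M) (hq : q ∈ W) := mfderiv_apply (hF q hq)
  obtain ⟨Ψ, hΨ, hpΨ, hΨW, hΨF, r, hr⟩ := exists_chart hW hpW hF fun q hq ↦ by
    have hqU := hVU (hWV hq)
    rw [injective_iff_map_eq_zero]
    intro u hu
    have h (i : Fin 3) : mvfderiv (𝓡 3) (fun r ↦ (!₂[x r, y r, k r] : E3) i) q u = 0 :=
      (hFd q hq u i).symm.trans
        ((congrArg (EuclideanSpace.proj i : E3 →L[ℝ] ℝ) hu).trans (map_zero _))
    have h0 : mvfderiv (𝓡 3) x q u = 0 := h 0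
    have h1 : mvfderiv (𝓡 3) y q u = 0 := h 1
    have h2 : mvfderiv (𝓡 3) k q u = 0 := h 2
    -- The coefficient of η in dk is nonzero because k < -1 and μ ≠ -2. Once η(u) = 0, dx and dy
    -- reduce to the components of u along X and φX.
    have he : S.eta q u = 0 := by
      rw [hz q hqU] at h2
      refine (mul_eq_zero.1 h2).resolve_right (neg_ne_zero.2 (mul_ne_zero (mul_ne_zero
        two_ne_zero ?_) ?_))
      · linarith [hk_lt q]
      · intro h
        exact hμ q (by linarith)
    rw [(hx q (hWV hq)).2, he, mul_zero, add_zero] at h0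
    rw [(hy q hq).2, he, mul_zero, add_zero] at h1
    rw [S.frame_decomp (hX.unit q hqU) (hX.horizontal q hqU) u, he, h0,
      show ⟪S.phi q (X q), u⟫ = 0 from h1]
    simp
  refine ⟨Ψ, hΨ, hpΨ, hΨW.trans (hWV.trans hVU), ⟨_, r, hr⟩, fun q hq ↦ ?_⟩
  have hqW := hΨW hq
  have hqU := hVU (hWV hqW)
  have hev : ∀ᶠ s in 𝓝 q, Ψ s = !₂[x s, y s, k s] := by
    filter_upwards [Ψ.open_source.mem_nhds hq] with s hs using hΨF s hs
  have hval := hΨF q hq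
  have hd (u : TangentSpace (𝓡 3) q) (w : E3)
      (h0 : mvfderiv (𝓡 3) x q u = w 0) (h1 : mvfderiv (𝓡 3) y q u = w 1)
      (h2 : mvfderiv (𝓡 3) k q u = w 2) : u = constField Ψ w q := by
    have h := mfderiv_apply (contMDiffAt_of_mem_maximalAtlas hΨ hq) u
    have e0 := h 0
    have e1 := h 1
    have e2 := h 2
    rw [mvfderiv_congr (g := x) (hev.mono fun s hs ↦ by simp [hs]), h0] at e0
    rw [mvfderiv_congr (g := y) (hev.mono fun s hs ↦ by simp [hs]), h1] at e1
    rw [mvfderiv_congr (g := k) (hev.mono fun s hs ↦ by simp [hs]), h2] at e2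
    refine eq_constField hΨ hq (PiLp.ext fun i ↦ ?_)
    fin_cases i <;> assumption
  have hc (i : Fin 3) : coordField Ψ i q = constField Ψ (EuclideanSpace.single i 1) q := rfl
  have hu := hX.unit q hqU
  have hh := hX.horizontal q hqU
  have hlin (u v w : ℝ) : constField Ψ !₂[u, v, w] q
      = u • coordField Ψ 0 q + v • coordField Ψ 1 q + w • coordField Ψ 2 q := by
    have : (!₂[u, v, w] : E3) = u • EuclideanSpace.single 0 (1 : ℝ)
        + v • EuclideanSpace.single 1 (1 : ℝ) + w • EuclideanSpace.single 2 (1 : ℝ) := by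
      ext i
      fin_cases i <;> simp
    let D : E3 →L[ℝ] TangentSpace (𝓡 3) q := (mfderiv (𝓡 3) 𝓘(ℝ, E3) Ψ q).inverse
    have hD (v : E3) : constField Ψ v q = D v := rfl
    rw [hc, hc, hc, hD, hD, hD, hD, this, map_add, map_add, map_smul, map_smul, map_smul]
  refine ⟨by simp [hval], ?_, ?_, ?_⟩
  · refine hd _ _ ?_ ?_ ?_
    · rw [(hx q (hWV hqW)).2, hh, hu]
      simp
    · rw [(hy q hqW).2, hh, phiField, real_inner_comm, S.inner_phi_self]
      simp
    · rw [hz q hqU, hh]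
      simp
  · refine hd _ _ ?_ ?_ ?_
    · rw [(hx q (hWV hqW)).2, S.eta_phi, S.inner_phi_self]
      simp
    · rw [(hy q hqW).2, S.eta_phi, phiField,
        show ⟪S.phi q (X q), S.phi q (X q)⟫ = 1 from hX.phiField.unit q hqU]
      simp
    · rw [hz q hqU, S.eta_phi]
      simp
  · have h1 : ⟪X q, S.xi q⟫ = 0 := by rw [real_inner_comm, ← eta_eq_inner, hh]
    have h2 : ⟪S.phi q (X q), S.xi q⟫ = 0 := by rw [real_inner_comm, ← eta_eq_inner, S.eta_phi]
    rw [hd (S.xi q) !₂[Ψ q 0 * (1 + √(-1 - k q)), Ψ q 1 * (1 - √(-1 - k q)),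
      -(2 * (k q + 1) * (μ q + 2))] ?_ ?_ ?_, hlin]
    · module
    · rw [(hx q (hWV hqW)).2, h1, S.eta_xi]
      simp [hval]
    · rw [(hy q hqW).2, phiField, h2, S.eta_xi]
      simp [hval]
    · rw [hz q hqU, S.eta_xi]
      simp

/-- Applying η to the formula for ξ gives 2(k + 1)(μ + 2)η(∂_z) = -1. Since dη = 0 and coordinate
fields commute, η(∂_z) is constant along ∂_x and ∂_y. So is k, hence also μ. -/
theorem IsEigenfieldOn.exists_normal_coordinates (hX : S.IsEigenfieldOn nabla k X U)
    (hS : S.IsAlmostKenmotsu) (hn : IsLeviCivita nabla) (hnull : S.KMuPrimeNullity nabla k μ)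
    (hk : ContMDiff (𝓡 3) 𝓘(ℝ, ℝ) ∞ k) (hμs : ContMDiff (𝓡 3) 𝓘(ℝ, ℝ) ∞ μ)
    (hk_lt : ∀ p, k p < -1)
    (hdk : ∀ (p : M) (u v : TangentSpace (𝓡 3) p),
      wedgeOneOne (mvfderiv (𝓡 3) k p) (S.eta p) u v = 0)
    (hμ : ∀ p, μ p ≠ -2) (hp : p ∈ U) :
    ∃ Ψ ∈ IsManifold.maximalAtlas (𝓡 3) ∞ M, p ∈ Ψ.source ∧ Ψ.source ⊆ U ∧
      ∃ m : ℝ → ℝ, ContDiffOn ℝ ∞ m ((fun q ↦ Ψ q 2) '' Ψ.source) ∧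
      ∀ q ∈ Ψ.source, k q = Ψ q 2 ∧ μ q = m (Ψ q 2) ∧
        X q = coordField Ψ 0 q ∧ S.phi q (X q) = coordField Ψ 1 q ∧
        S.xi q = (Ψ q 0 * (1 + √(-1 - k q))) • coordField Ψ 0 q
          + (Ψ q 1 * (1 - √(-1 - k q))) • coordField Ψ 1 q
          - (2 * (k q + 1) * (μ q + 2)) • coordField Ψ 2 q := by
  obtain ⟨Ψ, hΨ, hpΨ, hΨU, ⟨y, r, hball⟩, h⟩ :=
    hX.exists_adapted_chart hS hn hnull hk hk_lt hdk hμ hp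
  have he0 (q : M) (hq : q ∈ Ψ.source) : S.eta q (coordField Ψ 0 q) = 0 := by
    rw [← (h q hq).2.1, hX.horizontal q (hΨU hq)]
  have he1 (q : M) (hq : q ∈ Ψ.source) : S.eta q (coordField Ψ 1 q) = 0 := by
    rw [← (h q hq).2.2.1, S.eta_phi]
  have he2 (q : M) (hq : q ∈ Ψ.source) :
      2 * (k q + 1) * (μ q + 2) * S.eta q (coordField Ψ 2 q) = -1 := by
    have h1 := congrArg (S.eta q) (h q hq).2.2.2
    rw [map_sub, map_add, map_smul, map_smul, map_smul, S.eta_xi, he0 q hq, he1 q hq] at h1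
    simp only [smul_eq_mul] at h1
    linarith
  have hs (i : Fin 3) (q : M) (hq : q ∈ Ψ.source) : SmoothFieldAt (coordField Ψ i) q :=
    smoothFieldAt_constField hΨ hq _
  have hdμ (i : Fin 3) (hi : ∀ q ∈ Ψ.source, S.eta q (coordField Ψ i q) = 0) (q : M)
      (hq : q ∈ Ψ.source) : mvfderiv (𝓡 3) μ q (coordField Ψ i q) = 0 := by
    have hnhds := Ψ.open_source.mem_nhds hq
    -- As η(∂_i) vanishes identically and [∂_i, ∂_z] = 0, what is left of dη(∂_i, ∂_z) = 0 is
    -- ∂_i(η(∂_z)) = 0.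
    have h1 := hS.eta_closed _ _ q (hs i q hq) (hs 2 q hq)
    have hb : bracket (coordField Ψ i) (coordField Ψ 2) q = 0 := bracket_constField hΨ hq _ _
    rw [extDerivOne, hb, map_zero, sub_zero, derivAlong, derivAlong,
      mvfderiv_eq_zero_of_eventually_const
        (f := fun q ↦ S.eta q (coordField Ψ i q)) (c := 0)
        (by filter_upwards [hnhds] with s hs using hi s hs), zero_apply, sub_zero] at h1
    have hkd := (hk q).mdifferentiableAt (by simp)
    have hμd := (hμs q).mdifferentiableAt (by simp)
    have hηd := (contMDiffAt_eta (S := S) (hs 2 q hq)).mdifferentiableAt (by simp)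
    have ha : MDifferentiableAt (𝓡 3) 𝓘(ℝ, ℝ) (fun q ↦ k q + 1) q :=
      hkd.add mdifferentiableAt_const
    have hb : MDifferentiableAt (𝓡 3) 𝓘(ℝ, ℝ) (fun q ↦ μ q + 2) q :=
      hμd.add mdifferentiableAt_const
    have hdk0 : mvfderiv (𝓡 3) k q (coordField Ψ i q) = 0 := by
      rw [mvfderiv_eq_eta_mul hdk, hi q hq, zero_mul]
    have hab : MDifferentiableAt (𝓡 3) 𝓘(ℝ, ℝ) (fun q ↦ (k q + 1) * (μ q + 2)) q := ha.mul hb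
    have h2 := mvfderiv_eq_zero_of_eventually_const
      (f := fun q ↦ (k q + 1) * (μ q + 2) * S.eta q (coordField Ψ 2 q)) (p := q) (c := -1 / 2)
      (by filter_upwards [hnhds] with s hs using by linarith [he2 s hs])
    rw [mvfderiv_fun_mul hab hηd, mvfderiv_fun_mul ha hb,
      mvfderiv_fun_add hkd mdifferentiableAt_const, mvfderiv_fun_add hμd mdifferentiableAt_const,
      mvfderiv_const, mvfderiv_const] at h2
    have h3 := DFunLike.congr_fun h2 (coordField Ψ i q)
    simp only [add_apply, smul_apply, smul_eq_mul, zero_apply, h1, hdk0, mul_zero, zero_add,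
      add_zero] at h3
    have h4 := he2 q hq
    rcases mul_eq_zero.1 h3 with h5 | h5
    · rw [h5, mul_zero] at h4
      norm_num at h4
    · refine (mul_eq_zero.1 h5).resolve_left fun h6 ↦ ?_
      linarith [hk_lt q]
  have hν (x : E3) (hx : x ∈ Ψ.target) : ContDiffAt ℝ ∞ (μ ∘ Ψ.symm) x :=
    (ContMDiffAt.comp x (hμs _) (contMDiffAt_symm_of_mem_maximalAtlas hΨ hx)).contDiffAt
  have hdν (i : Fin 3) (hi : ∀ q ∈ Ψ.source, S.eta q (coordField Ψ i q) = 0) (x : E3)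
      (hx : x ∈ Ψ.target) : fderiv ℝ (μ ∘ Ψ.symm) x (EuclideanSpace.single i 1) = 0 := by
    have h1 := mvfderiv_eq_fderiv hΨ (Ψ.map_target hx) (hμs _) (coordField Ψ i (Ψ.symm x))
    have h2 : mfderiv (𝓡 3) 𝓘(ℝ, E3) Ψ (Ψ.symm x) (coordField Ψ i (Ψ.symm x))
      = EuclideanSpace.single i 1 := mfderiv_constField hΨ (Ψ.map_target hx) _
    rw [hdμ i hi _ (Ψ.map_target hx), h2, Ψ.right_inv hx] at h1
    exact h1.symm
  rw [hball] at hν hdν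
  obtain ⟨m, hm, hmν⟩ := exists_eq_of_fderiv_eq_zero hν (hdν 0 he0) (hdν 1 he1)
  have hmem (q : M) (hq : q ∈ Ψ.source) : Ψ q ∈ Metric.ball y r := hball ▸ Ψ.map_source hq
  refine ⟨Ψ, hΨ, hpΨ, hΨU, m, hm.mono ?_, fun q hq ↦ ⟨(h q hq).1, ?_, (h q hq).2⟩⟩
  · rintro _ ⟨q, hq, rfl⟩
    exact ⟨Ψ q, hmem q hq, rfl⟩
  · rw [← hmν _ (hmem q hq), Function.comp_apply, Ψ.left_inv hq]

omit [RiemannianBundle (fun p : M ↦ TangentSpace (𝓡 3) p)]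
  [IsContMDiffRiemannianBundle (𝓡 3) ∞ E3 (fun p : M ↦ TangentSpace (𝓡 3) p)] in
theorem exists_eq_const_of_mvfderiv_eq_zero [ConnectedSpace M] {f : M → ℝ}
    (hf : ContMDiff (𝓡 3) 𝓘(ℝ, ℝ) ∞ f) (hd : ∀ p, mvfderiv (𝓡 3) f p = 0) :
    ∃ c, ∀ p, f p = c := by
  have hloc : IsLocallyConstant f := by
    rw [IsLocallyConstant.iff_eventually_eq]
    intro p
    let c := chartAt E3 p
    have hc : c ∈ IsManifold.maximalAtlas (𝓡 3) ∞ M := IsManifold.chart_mem_maximalAtlas p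
    have hpc : p ∈ c.source := mem_chart_source E3 p
    obtain ⟨r, hr, hrT⟩ := Metric.isOpen_iff.1 c.open_target _ (c.map_source hpc)
    have hd0 (x : E3) (hx : x ∈ Metric.ball (c p) r) :
        HasFDerivAt (f ∘ c.symm) (0 : E3 →L[ℝ] ℝ) x := by
      have h1 : ContDiffAt ℝ ∞ (f ∘ c.symm) x := (ContMDiffAt.comp x (hf _)
        (contMDiffAt_symm_of_mem_maximalAtlas hc (hrT hx))).contDiffAt
      have h2 : fderiv ℝ (f ∘ c.symm) x = 0 := by
        ext v
        have h3 := mvfderiv_eq_fderiv hc (c.map_target (hrT hx)) (hf _)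
          (constField c v (c.symm x))
        rw [mfderiv_constField hc (c.map_target (hrT hx)), hd, c.right_inv (hrT hx)] at h3
        exact h3.symm
      rw [← h2]
      exact (h1.differentiableAt (by simp)).hasFDerivAt
    filter_upwards [c.open_source.mem_nhds hpc,
      (c.continuousAt hpc).preimage_mem_nhds (Metric.ball_mem_nhds _ hr)] with q hq hqb
    have h4 := (convex_ball (c p) r).is_const_of_fderivWithin_eq_zero (𝕜 := ℝ)
      (f := f ∘ c.symm)
      (fun x hx ↦ (hd0 x hx).differentiableAt.differentiableWithinAt)
      (fun x hx ↦ (hd0 x hx).hasFDerivWithinAt.fderivWithin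
        (Metric.isOpen_ball.uniqueDiffWithinAt hx)) hqb (Metric.mem_ball_self hr)
    simpa [c.left_inv hq, c.left_inv hpc] using h4
  obtain ⟨p⟩ := (inferInstance : Nonempty M)
  exact ⟨f p, fun q ↦ hloc.apply_eq_of_preconnectedSpace q p⟩

end AlmostContactMetric

end

end AlmostKenmotsu

end

/-! ### The classification. -/

theorem theorem5p3
    {M : Type*} [TopologicalSpace M] [T2Space M] [SecondCountableTopology M] [ConnectedSpace M]
    [ChartedSpace AlmostKenmotsu.E3 M] [IsManifold (𝓡 3) ∞ M]
    [RiemannianBundle (fun p : M ↦ TangentSpace (𝓡 3) p)]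
    [IsContMDiffRiemannianBundle (𝓡 3) ∞ AlmostKenmotsu.E3 (fun p : M ↦ TangentSpace (𝓡 3) p)]
    (S : AlmostKenmotsu.AlmostContactMetric M) (hS : S.IsAlmostKenmotsu)
    (nabla : CovariantDerivative (𝓡 3) AlmostKenmotsu.E3 (fun p : M ↦ TangentSpace (𝓡 3) p))
    (hnabla : AlmostKenmotsu.IsLeviCivita nabla)
    (k μ : M → ℝ)
    (hk : ContMDiff (𝓡 3) 𝓘(ℝ, ℝ) ∞ k) (hμ : ContMDiff (𝓡 3) 𝓘(ℝ, ℝ) ∞ μ)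
    (hnull : S.KMuPrimeNullity nabla k μ)
    (hdk : ∀ (p : M) (u v : TangentSpace (𝓡 3) p),
      AlmostKenmotsu.wedgeOneOne (mvfderiv (𝓡 3) k p) (S.eta p) u v = 0)
    (hk_lt : ∀ p : M, k p < -1) :
    ((∀ p : M, μ p = -2) → ∃ c : ℝ, ∀ p : M, k p = c) ∧
    ((∀ p : M, μ p ≠ -2) → ∀ p : M,
      ∃ Ψ ∈ IsManifold.maximalAtlas (𝓡 3) ∞ M, p ∈ Ψ.source ∧
      ∃ (X : (q : M) → TangentSpace (𝓡 3) q) (m f r : ℝ → ℝ),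
        ContDiffOn ℝ ∞ m ((fun q ↦ Ψ q 2) '' Ψ.source) ∧
        ContDiffOn ℝ ∞ f ((fun q ↦ Ψ q 2) '' Ψ.source) ∧
        ContDiffOn ℝ ∞ r ((fun q ↦ Ψ q 2) '' Ψ.source) ∧
        ∀ q ∈ Ψ.source,
          Ψ q 2 < -1 ∧
          Orthonormal ℝ ![S.xi q, X q, S.phi q (X q)] ∧
          S.h' S.xi q = 0 ∧
          S.h' X q = √(-1 - k q) • X q ∧
          S.h' (S.phiField X) q = -√(-1 - k q) • S.phi q (X q) ∧
          k q = Ψ q 2 ∧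
          μ q = m (Ψ q 2) ∧
          X q = AlmostKenmotsu.coordField Ψ 0 q ∧
          S.phi q (X q) = AlmostKenmotsu.coordField Ψ 1 q ∧
          S.xi q =
            (Ψ q 0 * (1 + √(-1 - Ψ q 2)) + f (Ψ q 2)) • AlmostKenmotsu.coordField Ψ 0 q
            + (Ψ q 1 * (1 - √(-1 - Ψ q 2)) + r (Ψ q 2)) • AlmostKenmotsu.coordField Ψ 1 q
            - (2 * (Ψ q 2 + 1) * (μ q + 2)) • AlmostKenmotsu.coordField Ψ 2 q) := by
  refine ⟨fun hμ2 ↦ ?_, fun hμ2 p ↦ ?_⟩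
  · refine AlmostKenmotsu.AlmostContactMetric.exists_eq_const_of_mvfderiv_eq_zero hk fun p ↦ ?_
    obtain ⟨X, U, hp, hX⟩ :=
      AlmostKenmotsu.AlmostContactMetric.exists_isEigenfieldOn hS hnabla hnull hk hk_lt p
    ext v
    -- dk = ξ(k)η, and ξ(k) contains the factor μ + 2 = 0.
    rw [AlmostKenmotsu.AlmostContactMetric.mvfderiv_eq_eta_mul hdk,
      hX.mvfderiv_xi hS hnabla hnull hk hk_lt hp, hμ2 p]
    simp
  · obtain ⟨X, U, hp, hX⟩ :=
      AlmostKenmotsu.AlmostContactMetric.exists_isEigenfieldOn hS hnabla hnull hk hk_lt p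
    obtain ⟨Ψ, hΨ, hpΨ, hΨU, m, hm, h⟩ :=
      hX.exists_normal_coordinates hS hnabla hnull hk hμ hk_lt hdk hμ2 hp
    -- The relations dx = X♭ + x(1 + λ)η and dy = (φX)♭ + y(1 - λ)η have no inhomogeneous η-term, so
    -- in this chart f = r = 0.
    refine ⟨Ψ, hΨ, hpΨ, X, m, fun _ ↦ 0, fun _ ↦ 0, hm, contDiffOn_const, contDiffOn_const,
      fun q hq ↦ ?_⟩
    obtain ⟨hkq, hμq, hX0, hX1, hxi⟩ := h q hq
    have hqU := hΨU hq
    refine ⟨hkq ▸ hk_lt q, S.orthonormal_frame (hX.unit q hqU) (hX.horizontal q hqU),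
      congrFun S.h'_xi q, ?_, ?_, hkq, hμq, hX0, hX1, ?_⟩
    · rw [hX.h'_eq hS hnabla hqU, hX.eigen q hqU]
      module
    · rw [hX.phiField.h'_eq hS hnabla hqU]
      change nabla S.xi q (S.phi q (X q)) - S.phi q (X q) = _
      rw [hX.eigen_phi hS hnabla hqU]
      module
    · simpa only [add_zero, hkq] using hxi
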